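/- Consider a source that sends status updates to a destination through a half-duplex relay. A source transmission takes $d>0$ time units and a relay transmission takes $\bar d>0$ time units. Each source transmission consumes $E>0$ units of energy and each relay transmission $\bar E>0$ units. Energy packets of size $E$ (resp. $\bar E$) arrive at the source (resp. relay) according to two independent Poisson processes of unit rate; batteries are infinite, and initially the source holds $E$ and the relay $\bar E$ units of energy. A feasible policy consists of random times $t_1,t_2,\dots$ and $\bar t_1,\bar t_2,\dots$ in $[0,\infty]$ at which the source, resp. the relay, starts to transmit the $i$th update ($\infty$ meaning never), such that almost surely, for all $i$: $t_i+d\le\bar t_i$, $\bar t_i+\bar d\le t_{i+1}$, and, whenever $t_i<\infty$ (resp. $\bar t_i<\infty$), the source (resp. relay) battery holds at least $E$ (resp. $\bar E$) right before $t_i$ (resp. $\bar t_i$). The policy is online if for every $u\ge 0$ the events $\{t_i\le u\}$ and $\{\bar t_i\le u\}$ are determined by the energy arrivals at both nodes in $[0,u)$. The age of information is $a(t)=t-u(t)$, where $u(t)$ is the source transmission time of the latest update received at the destination by time $t$ (update $i$ is received at $\bar t_i+\bar d$), and $u(t)=0$ if there is none. The long-term average AoI of a policy is $\limsup_{T\to\infty}\frac1T\,\mathbb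 E\left[\int_0^T a(t)\,dt\right]$. The best-effort uniform update policy with service constraints schedules updates at the times $\ell_n=n\max\{1,d+\bar d\}$, $n=0,1,2,\dots$. If right before $\ell_n$ the source and the relay hold at least $E$ and $\bar E$ units of energy, respectively, then the source transmits an update at $\ell_n$ and the relay forwards it at $\ell_n+d$; otherwise both stay silent until $\ell_{n+1}$. Theorem. The best-effort uniform update policy is feasible and online, and its long-term average AoI equals $$\max\left\{\tfrac12+d+\bar d,\ \tfrac32(d+\bar d)\right\}.$$ Every feasible policy, online or not, has long-term average AoI at least this value. Hence the best-effort uniform update policy is optimal. -/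

import Mathlib

open MeasureTheory ProbabilityTheory Filter
open scoped ENNReal

/-- The number of arrivals in the interval `[a, b)`, where `s k` is the time of the
`k`-th arrival. -/
noncomputable def arrivals (s : ℕ → ℝ) (a b : ℝ) : ℕ :=
  Set.ncard {k : ℕ | a ≤ s k ∧ s k < b}

/-- `s 0 ≤ s 1 ≤ …` are the arrival times of a Poisson process of unit rate on `[0, ∞)`:
only finitely many arrivals occur in bounded time, the number of arrivals in `[a, b)` is Poisson
with mean `b - a`, and the numbers of arrivals in successive intervals are independent. -/
structure IsUnitPoissonProcess {Ω : Type*} [MeasurableSpace Ω] (P : Measure Ω)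
    (s : ℕ → Ω → ℝ) : Prop where
  measurable : ∀ k, Measurable (s k)
  nonneg : ∀ k ω, 0 ≤ s k ω
  mono : ∀ ω, Monotone (fun k => s k ω)
  tendsto : ∀ ω, Tendsto (fun k => s k ω) atTop atTop
  law : ∀ a b : ℝ, 0 ≤ a → a ≤ b →
    HasLaw (fun ω => arrivals (fun k => s k ω) a b) (poissonMeasure (b - a).toNNReal) P
  indep : ∀ τ : ℕ → ℝ, 0 ≤ τ 0 → Monotone τ →
    iIndepFun (fun (j : ℕ) ω => arrivals (fun k => s k ω) (τ j) (τ (j + 1))) P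

/-- A (random) transmission policy: `t i` and `tbar i` are the times at which the `i`-th update
(`i = 0, 1, 2, …`) is transmitted by the source and by the relay. The value `∞` means that the
transmission never takes place. -/
structure Policy (Ω : Type*) where
  t : ℕ → Ω → ℝ≥0∞
  tbar : ℕ → Ω → ℝ≥0∞

/-- The energy in a battery right before the `i`-th transmission time `t i`: the battery
holds one packet of `e` units of energy at time `0`, every arrival brings `e` units and every
transmission consumes `e` units. (Only used at indices for which `t i` is finite.) -/
noncomputable def batteryLevel (e : ℝ) (s : ℕ → ℝ) (t : ℕ → ℝ≥0∞) : ℕ → ℝ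
  | 0 => e + e * arrivals s 0 (t 0).toReal
  | i + 1 => batteryLevel e s t i - e + e * arrivals s (t i).toReal (t (i + 1)).toReal

/-- Feasible transmission times: data causality, reduced half-duplex constraints, and
energy causality at the source and at the relay, almost surely. -/
structure Policy.IsFeasible {Ω : Type*} [MeasurableSpace Ω] (P : Measure Ω)
    (s sbar : ℕ → Ω → ℝ) (d dbar E Ebar : ℝ) (π : Policy Ω) : Prop where
  measurable_t : ∀ i, Measurable (π.t i)
  measurable_tbar : ∀ i, Measurable (π.tbar i)
  data : ∀ᵐ ω ∂P, ∀ i, π.t i ω + ENNReal.ofReal d ≤ π.tbar i ω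
  halfDuplex : ∀ᵐ ω ∂P, ∀ i, π.tbar i ω + ENNReal.ofReal dbar ≤ π.t (i + 1) ω
  energy : ∀ᵐ ω ∂P, ∀ i, π.t i ω ≠ ∞ →
    E ≤ batteryLevel E (fun k => s k ω) (fun j => π.t j ω) i
  energyBar : ∀ᵐ ω ∂P, ∀ i, π.tbar i ω ≠ ∞ →
    Ebar ≤ batteryLevel Ebar (fun k => sbar k ω) (fun j => π.tbar j ω) i

/-- The information available right before time `u`: all arrivals at both nodes in `[0, u)`. -/
@[reducible] noncomputable def history {Ω : Type*} (s sbar : ℕ → Ω → ℝ) (u : ℝ) : MeasurableSpace Ω :=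
  ⨆ v : Set.Icc (0 : ℝ) u,
    (MeasurableSpace.comap (fun ω => arrivals (fun k => s k ω) 0 v) ⊤ ⊔
      MeasurableSpace.comap (fun ω => arrivals (fun k => sbar k ω) 0 v) ⊤)

/-- A policy is online if whether a transmission has started by time `u` is decided by
the arrivals before time `u`, at the source and the relay. -/
def Policy.IsOnline {Ω : Type*} (s sbar : ℕ → Ω → ℝ) (π : Policy Ω) : Prop :=
  ∀ (i : ℕ) (u : ℝ), 0 ≤ u →
    MeasurableSet[history s sbar u] {ω | π.t i ω ≤ ENNReal.ofReal u} ∧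
    MeasurableSet[history s sbar u] {ω | π.tbar i ω ≤ ENNReal.ofReal u}

/-- The time stamp (source transmission time) of the latest update received at the destination
by time `τ`; it is `0` as long as no update has been received. The `i`-th update is received at
time `tbar i + dbar`; under the feasibility constraints updates are received in the order of
their time stamps, so the latest received update is the one with the largest time stamp. -/
noncomputable def Policy.stamp {Ω : Type*} (dbar : ℝ) (π : Policy Ω) (τ : ℝ) (ω : Ω) : ℝ≥0∞ :=
  ⨆ (i : ℕ) (_ : π.tbar i ω + ENNReal.ofReal dbar ≤ ENNReal.ofReal τ), π.t i ω

/-- The age of information at time `τ`. -/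
noncomputable def Policy.age {Ω : Type*} (dbar : ℝ) (π : Policy Ω) (τ : ℝ) (ω : Ω) : ℝ≥0∞ :=
  ENNReal.ofReal τ - π.stamp dbar τ ω

/-- The area under the age curve over `[0, T]`. -/
noncomputable def Policy.area {Ω : Type*} (dbar : ℝ) (π : Policy Ω) (T : ℝ) (ω : Ω) : ℝ≥0∞ :=
  ∫⁻ τ in Set.Icc (0 : ℝ) T, π.age dbar τ ω

/-- The long term average age of information: the upper limit, as `T → ∞`, of the expected area
under the age curve over `[0, T]` divided by `T`. -/
noncomputable def Policy.longTermAoI {Ω : Type*} [MeasurableSpace Ω] (P : Measure Ω)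
    (dbar : ℝ) (π : Policy Ω) : ℝ≥0∞ :=
  limsup (fun T : ℝ => (∫⁻ ω, π.area dbar T ω ∂P) / ENNReal.ofReal T) atTop

/-- The scheduled update times `n * max {1, d + dbar}`. -/
noncomputable def slot (d dbar : ℝ) (n : ℕ) : ℝ := n * max 1 (d + dbar)

open Classical in
/-- The energies in the batteries of the source and the relay right before the `n`-th scheduled
update time, under the best effort policy: if both nodes have enough energy, then each
of them spends one packet on the update (the relay forwards it within the same time slot);
otherwise both stay silent. -/
noncomputable def bestEffortBatteries (d dbar E Ebar : ℝ) (s sbar : ℕ → ℝ) : ℕ → ℝ × ℝ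
  | 0 => (E, Ebar)
  | n + 1 =>
    let b := bestEffortBatteries d dbar E Ebar s sbar n
    let r : ℝ × ℝ := if E ≤ b.1 ∧ Ebar ≤ b.2 then (b.1 - E, b.2 - Ebar) else b
    (r.1 + E * arrivals s (slot d dbar n) (slot d dbar (n + 1)),
      r.2 + Ebar * arrivals sbar (slot d dbar n) (slot d dbar (n + 1)))

/-- An update is transmitted at the `n`-th scheduled update time: both nodes have enough energy. -/
def BestEffortSends (d dbar E Ebar : ℝ) (s sbar : ℕ → ℝ) (n : ℕ) : Prop :=
  E ≤ (bestEffortBatteries d dbar E Ebar s sbar n).1 ∧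
    Ebar ≤ (bestEffortBatteries d dbar E Ebar s sbar n).2

open Classical in
/-- The source transmission time of the `i`-th update under the best effort policy: the
scheduled time at which a transmission takes place and before which exactly `i` scheduled times
were successful (`∞` if there is none). -/
noncomputable def bestEffortTime (d dbar E Ebar : ℝ) (s sbar : ℕ → ℝ) (i : ℕ) : ℝ≥0∞ :=
  ⨅ (n : ℕ) (_ : BestEffortSends d dbar E Ebar s sbar n ∧
      Nat.count (BestEffortSends d dbar E Ebar s sbar) n = i), ENNReal.ofReal (slot d dbar n)

/-- The best effort uniform update policy with service constraints. The relay forwards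
every update directly once it is received, i.e. `d` time units after the source has started. -/
noncomputable def bestEffort {Ω : Type*} (d dbar E Ebar : ℝ) (s sbar : ℕ → Ω → ℝ) : Policy Ω where
  t i ω := bestEffortTime d dbar E Ebar (fun k => s k ω) (fun k => sbar k ω) i
  tbar i ω :=
    bestEffortTime d dbar E Ebar (fun k => s k ω) (fun k => sbar k ω) i + ENNReal.ofReal d

/-! Write D = d + dbar and L = max 1 D; the claimed value is D + L/2.

Lower bound. An age below K = D + L can only be due to a received update, and update i is received
no earlier than `t i` + D, when its age is already D. Hence each update lowers the area under the
age curve, relative to the constant level K, by at most a triangle of area L²/2, and the initial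
condition `u = 0` costs one more bounded triangle (`le_age_add`, `mul_le_area_add`). This linear
bound replaces a convexity argument for the interarrival times. The expected number of updates
started up to time T is at most 1 + T/L: energy causality at the source gives 1 + T
(`lt_arrivals_add_one`), the half-duplex constraints give 1 + T/D (`lt_floor_add_one`). So the
expected area is at least (D + L)T - (T/L)(L²/2) - O(1) = (D + L/2)T - O(1).

Upper bound. If every slot were used, the age would run from D to D + L in each period and average D
+ L/2. At slot n the excess is L times the number of slots since the last transmission, which is the
sum over k of the indicators of being idle at slots n - k, …, n. Two bounds control these events.
Idleness over k periods forces one node to have no arrivals there, so its probability is at most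
2e^{-k} (`measureReal_bestEffortIdle_le`). It also implies a miss at slot n - k, and the frequency
of misses tends to zero by the strong law, even when L = 1 and the energy only just suffices
(`tendsto_missed_div`). Dominated convergence over k makes the average excess vanish
(`tendsto_average_triangular`). -/

/-! ### Counting arrivals and energy; Poisson means -/

lemma finite_arrivals {s : ℕ → ℝ} (hs : Tendsto s atTop atTop) (a b : ℝ) :
    {k : ℕ | a ≤ s k ∧ s k < b}.Finite := by
  obtain ⟨N, hN⟩ := eventually_atTop.1 (hs.eventually_ge_atTop b)
  refine (Set.finite_Iio N).subset fun k hk => ?_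
  by_contra h
  exact absurd (hN k (not_lt.1 h)) (not_le.2 hk.2)

lemma arrivals_add {s : ℕ → ℝ} (hs : Tendsto s atTop atTop) {a b c : ℝ} (hab : a ≤ b)
    (hbc : b ≤ c) : arrivals s a b + arrivals s b c = arrivals s a c := by
  unfold arrivals
  rw [← Set.ncard_union_eq _ (finite_arrivals hs a b) (finite_arrivals hs b c)]
  · congr 1
    ext k
    simp only [Set.mem_union, Set.mem_ofPred_eq]
    constructor
    · rintro (h | h) <;> constructor <;> linarith [h.1, h.2]
    · rintro ⟨h1, h2⟩
      rcases lt_or_ge (s k) b with h | h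
      · exact Or.inl ⟨h1, h⟩
      · exact Or.inr ⟨h, h2⟩
  · rw [Set.disjoint_left]
    rintro k ⟨_, h1⟩ ⟨h2, _⟩
    linarith

lemma arrivals_mono_right {s : ℕ → ℝ} (hs : Tendsto s atTop atTop) {a b c : ℝ} (hbc : b ≤ c) :
    arrivals s a b ≤ arrivals s a c :=
  Set.ncard_le_ncard (fun _ hk => ⟨hk.1, hk.2.trans_le hbc⟩) (finite_arrivals hs a c)

lemma arrivals_self (s : ℕ → ℝ) (a : ℝ) : arrivals s a a = 0 := by
  have : {k : ℕ | a ≤ s k ∧ s k < a} = ∅ := by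
    ext k; simp
  rw [arrivals, this, Set.ncard_empty]

lemma sum_arrivals {s : ℕ → ℝ} (hs : Tendsto s atTop atTop) {τ : ℕ → ℝ} (hτ : Monotone τ)
    (n : ℕ) : ∑ j ∈ Finset.range n, arrivals s (τ j) (τ (j + 1)) = arrivals s (τ 0) (τ n) := by
  induction n with
  | zero => simp [arrivals_self]
  | succ n ih =>
    rw [Finset.sum_range_succ, ih, arrivals_add hs (hτ (Nat.zero_le _)) (hτ n.le_succ)]

/-- By monotonicity the arrivals before `v` form an initial segment of indices. This passes
measurability from the arrival times to the counts. -/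
lemma lt_arrivals_zero_iff {s : ℕ → ℝ} (h0 : ∀ k, 0 ≤ s k) (hm : Monotone s)
    (hs : Tendsto s atTop atTop) (v : ℝ) (n : ℕ) : n < arrivals s 0 v ↔ s n < v := by
  unfold arrivals
  constructor
  · intro h
    by_contra hv
    have : {k : ℕ | 0 ≤ s k ∧ s k < v} ⊆ Set.Iio n := by
      intro k hk
      by_contra hkn
      have := hm (not_lt.1 hkn)
      linarith [hk.2]
    have := Set.ncard_le_ncard this (Set.finite_Iio n)
    rw [← Finset.coe_Iio, Set.ncard_coe_finset, Nat.card_Iio] at this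
    omega
  · intro h
    have : Set.Iic n ⊆ {k : ℕ | 0 ≤ s k ∧ s k < v} :=
      fun k hk => ⟨h0 k, (hm hk).trans_lt h⟩
    have := Set.ncard_le_ncard this (finite_arrivals hs 0 v)
    rw [← Finset.coe_Iic, Set.ncard_coe_finset, Nat.card_Iic] at this
    omega

/-- The recursion telescopes as long as the times are ordered and finite; at `∞` the value `toReal =
0` would break it. Energy causality then reads `i ≤ arrivals`. -/
lemma batteryLevel_eq {s : ℕ → ℝ} (hs : Tendsto s atTop atTop) (e : ℝ) (t : ℕ → ℝ≥0∞) (i : ℕ)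
    (hmono : ∀ j < i, t j ≤ t (j + 1)) (hfin : t i ≠ ∞) :
    batteryLevel e s t i = e + e * arrivals s 0 (t i).toReal - i * e := by
  induction i with
  | zero => simp [batteryLevel]
  | succ i ih =>
    have hle := hmono i i.lt_succ_self
    have hfin' : t i ≠ ∞ := ne_top_of_le_ne_top hfin hle
    rw [batteryLevel, ih (fun j hj => hmono j (by omega)) hfin',
      ← arrivals_add hs ENNReal.toReal_nonneg (ENNReal.toReal_mono hfin hle)]
    push_cast
    ring

namespace IsUnitPoissonProcess

variable {Ω : Type*} [MeasurableSpace Ω] {P : Measure Ω} {s : ℕ → Ω → ℝ}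

lemma measurable_arrivals_zero (hs : IsUnitPoissonProcess P s) (v : ℝ) :
    Measurable fun ω => arrivals (fun k => s k ω) 0 v := by
  refine measurable_of_Ioi fun n => ?_
  have : (fun ω => arrivals (fun k => s k ω) 0 v) ⁻¹' Set.Ioi n = {ω | s n ω < v} := by
    ext ω
    exact lt_arrivals_zero_iff (fun k => hs.nonneg k ω) (hs.mono ω) (hs.tendsto ω) v n
  rw [this]
  exact measurableSet_lt (hs.measurable n) measurable_const

lemma history_le {sbar : ℕ → Ω → ℝ} (hs : IsUnitPoissonProcess P s)
    (hsbar : IsUnitPoissonProcess P sbar) (u : ℝ) :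
    history s sbar u ≤ ‹MeasurableSpace Ω› :=
  iSup_le fun v => sup_le (hs.measurable_arrivals_zero v).comap_le
    (hsbar.measurable_arrivals_zero v).comap_le

lemma lintegral_arrivals (hs : IsUnitPoissonProcess P s) {T : ℝ} (hT : 0 ≤ T) :
    ∫⁻ ω, (arrivals (fun k => s k ω) 0 T : ℝ≥0∞) ∂P = ENNReal.ofReal T := by
  have h := hs.law 0 T le_rfl hT
  rw [← lintegral_map' (f := fun n : ℕ => (n : ℝ≥0∞)) (by fun_prop) h.aemeasurable, h.map_eq]
  rw [poissonMeasure, lintegral_sum_measure]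
  simp only [lintegral_smul_measure, lintegral_dirac, sub_zero, smul_eq_mul,
    Real.coe_toNNReal T hT]
  have hexp : HasSum (fun n : ℕ => Real.exp (-T) * T ^ n / n.factorial * n) T := by
    have h1 : HasSum (fun n : ℕ => Real.exp (-T) * T * (T ^ n / n.factorial)) T := by
      have := (NormedSpace.expSeries_div_hasSum_exp (T : ℝ)).mul_left (Real.exp (-T) * T)
      rw [← Real.exp_eq_exp_ℝ, mul_right_comm, ← Real.exp_add] at this
      simpa using this
    -- The term at 0 vanishes; after the shift, the factor n + 1 cancels against the factorial and
    -- leaves T times the exponential series.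
    rw [← hasSum_nat_add_iff' 1]
    simp only [Finset.range_one, Finset.sum_singleton, Nat.cast_zero, mul_zero, sub_zero]
    refine h1.congr_fun fun n => ?_
    rw [Nat.factorial_succ]
    push_cast
    have : (n : ℝ) + 1 ≠ 0 := by positivity
    field_simp
    ring
  rw [← hexp.tsum_eq, ENNReal.ofReal_tsum_of_nonneg (fun n => by positivity) hexp.summable]
  congr 1
  ext n
  rw [hexp.tsum_eq, ENNReal.ofReal_mul (by positivity), ENNReal.ofReal_natCast]

end IsUnitPoissonProcess

/-! ### Lower bound for every feasible policy -/

lemma setLIntegral_Ici_ofReal_sub_le (a : ℝ) {c : ℝ} (hc : 0 ≤ c) :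
    ∫⁻ τ in Set.Ici a, ENNReal.ofReal (a + c - τ) ≤ ENNReal.ofReal (c ^ 2 / 2) := by
  have hsub : Set.Ici a ⊆ Set.Icc a (a + c) ∪ Set.Ioi (a + c) := by
    intro x hx
    rcases le_or_gt x (a + c) with h | h
    · exact Or.inl ⟨hx, h⟩
    · exact Or.inr h
  have h0 : ∫⁻ τ in Set.Ioi (a + c), ENNReal.ofReal (a + c - τ) = 0 := by
    rw [setLIntegral_congr_fun (g := fun _ => 0) measurableSet_Ioi, lintegral_zero]
    intro x hx
    exact ENNReal.ofReal_of_nonpos (sub_nonpos.2 (le_of_lt hx))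
  have h1 : ∫⁻ τ in Set.Icc a (a + c), ENNReal.ofReal (a + c - τ) = ENNReal.ofReal (c ^ 2 / 2) := by
    rw [← ofReal_integral_eq_lintegral_ofReal]
    · rw [integral_Icc_eq_integral_Ioc, ← intervalIntegral.integral_of_le (by linarith)]
      rw [intervalIntegral.integral_sub (by simp) (by simp)]
      simp only [intervalIntegral.integral_const, integral_id, smul_eq_mul]
      congr 1
      ring
    · exact (by fun_prop : Continuous fun τ => a + c - τ).continuousOn.integrableOn_Icc
    · exact (ae_restrict_iff' measurableSet_Icc).2
        (Eventually.of_forall fun x hx => sub_nonneg.2 hx.2)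
  calc _ ≤ _ := lintegral_mono_set hsub
    _ ≤ _ := lintegral_union_le _ _ _
    _ = _ := by rw [h0, h1, add_zero]

namespace Policy

variable {Ω : Type*} {π : Policy Ω} {ω : Ω} {d dbar T : ℝ} {n : ℕ}

/-- If the current stamp is `t i`, the shortfall of the age below `K` is `K + t i - τ`, which is the
`i`-th summand, and data causality puts `τ` beyond `t i + d + dbar`. Summing over all `i` avoids
identifying the latest update. -/
lemma le_age_add (hd : 0 ≤ d) (hdbar : 0 ≤ dbar)
    (hdata : ∀ i, π.t i ω + ENNReal.ofReal d ≤ π.tbar i ω)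
    (hn : ∀ i, π.t i ω ≤ ENNReal.ofReal T → i < n) {τ : ℝ} (hτ : 0 ≤ τ) (hτT : τ ≤ T) {K : ℝ}
    (hK : 0 ≤ K) :
    ENNReal.ofReal K ≤ π.age dbar τ ω + (ENNReal.ofReal (K - τ) + ∑ i ∈ Finset.range n,
      (Set.Ici ((π.t i ω).toReal + (d + dbar))).indicator
        (fun τ => ENNReal.ofReal (K + (π.t i ω).toReal - τ)) τ) := by
  set R := ENNReal.ofReal (K - τ) + ∑ i ∈ Finset.range n,
      (Set.Ici ((π.t i ω).toReal + (d + dbar))).indicator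
        (fun τ => ENNReal.ofReal (K + (π.t i ω).toReal - τ)) τ with hR
  -- The summand `K - τ` covers the case where nothing has been received; it also makes the
  -- truncated subtraction of `K` below exact.
  have hKle : ENNReal.ofReal K ≤ ENNReal.ofReal τ + R := by
    calc ENNReal.ofReal K ≤ ENNReal.ofReal (τ + (K - τ)) := by rw [add_sub_cancel]
      _ ≤ ENNReal.ofReal τ + ENNReal.ofReal (K - τ) := ENNReal.ofReal_add_le
      _ ≤ _ := by gcongr; exact le_self_add
  have hstamp : π.stamp dbar τ ω ≤ ENNReal.ofReal τ + R - ENNReal.ofReal K := by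
    refine iSup₂_le fun i hi => ?_
    have h1 : π.t i ω + ENNReal.ofReal (d + dbar) ≤ ENNReal.ofReal τ := by
      rw [ENNReal.ofReal_add hd hdbar, ← add_assoc]
      exact (add_le_add (hdata i) le_rfl).trans hi
    have hfin : π.t i ω ≠ ∞ :=
      ne_top_of_le_ne_top ENNReal.ofReal_ne_top (le_self_add.trans h1)
    have hin : i < n := hn i ((le_self_add.trans h1).trans (ENNReal.ofReal_le_ofReal hτT))
    obtain ⟨x, hx⟩ : ∃ x : ℝ, x = (π.t i ω).toReal := ⟨_, rfl⟩
    have hx0 : 0 ≤ x := hx ▸ ENNReal.toReal_nonneg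
    have hti : π.t i ω = ENNReal.ofReal x := by rw [hx, ENNReal.ofReal_toReal hfin]
    have h2 : x + (d + dbar) ≤ τ := by
      rw [hti, ← ENNReal.ofReal_add hx0 (by positivity)] at h1
      exact (ENNReal.ofReal_le_ofReal_iff hτ).1 h1
    have hterm : ENNReal.ofReal (K + x - τ) ≤ R := by
      refine le_trans ?_ le_add_self
      refine le_trans ?_ (Finset.single_le_sum (fun _ _ => zero_le) (Finset.mem_range.2 hin))
      rw [Set.indicator_of_mem (by rw [← hx]; exact h2), ← hx]
    refine ENNReal.le_sub_of_add_le_right ENNReal.ofReal_ne_top ?_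
    calc π.t i ω + ENNReal.ofReal K = ENNReal.ofReal (τ + (K + x - τ)) := by
          rw [hti, ← ENNReal.ofReal_add hx0 hK]; congr 1; ring
      _ ≤ ENNReal.ofReal τ + ENNReal.ofReal (K + x - τ) := ENNReal.ofReal_add_le
      _ ≤ _ := by gcongr
  have h3 : π.stamp dbar τ ω + ENNReal.ofReal K ≤ ENNReal.ofReal τ + R := by
    calc _ ≤ ENNReal.ofReal τ + R - ENNReal.ofReal K + ENNReal.ofReal K := by gcongr
      _ = _ := tsub_add_cancel_of_le hKle
  calc ENNReal.ofReal K ≤ ENNReal.ofReal τ + R - π.stamp dbar τ ω := by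
        refine ENNReal.le_sub_of_add_le_left ?_ h3
        refine ne_top_of_le_ne_top ENNReal.ofReal_ne_top (b := ENNReal.ofReal τ) ?_
        refine iSup₂_le fun i hi => le_trans ?_ hi
        exact (le_self_add.trans (hdata i)).trans le_self_add
    _ ≤ _ := add_tsub_le_tsub_add

/-- Integration of `le_age_add`: each update contributes a triangle that starts at height `c` at its
earliest possible reception. -/
lemma mul_le_area_add (hd : 0 ≤ d) (hdbar : 0 ≤ dbar)
    (hdata : ∀ i, π.t i ω + ENNReal.ofReal d ≤ π.tbar i ω)
    (hn : ∀ i, π.t i ω ≤ ENNReal.ofReal T → i < n) {c : ℝ} (hc : 0 ≤ c) :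
    ENNReal.ofReal (d + dbar + c) * ENNReal.ofReal T ≤ π.area dbar T ω +
      (ENNReal.ofReal ((d + dbar + c) ^ 2 / 2) + n * ENNReal.ofReal (c ^ 2 / 2)) := by
  set K := d + dbar + c with hK
  have hK0 : 0 ≤ K := by positivity
  have hmeas : ∀ i, Measurable ((Set.Ici ((π.t i ω).toReal + (d + dbar))).indicator
        (fun τ => ENNReal.ofReal (K + (π.t i ω).toReal - τ))) := fun i =>
    Measurable.indicator (by fun_prop) measurableSet_Ici
  calc ENNReal.ofReal K * ENNReal.ofReal T = ∫⁻ _ in Set.Icc (0 : ℝ) T, ENNReal.ofReal K := by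
        simp
    _ ≤ ∫⁻ τ in Set.Icc (0 : ℝ) T, (π.age dbar τ ω + (ENNReal.ofReal (K - τ) +
          ∑ i ∈ Finset.range n, (Set.Ici ((π.t i ω).toReal + (d + dbar))).indicator
            (fun τ => ENNReal.ofReal (K + (π.t i ω).toReal - τ)) τ)) :=
        setLIntegral_mono' measurableSet_Icc fun τ hτ =>
          le_age_add hd hdbar hdata hn hτ.1 hτ.2 hK0
    _ = π.area dbar T ω + ((∫⁻ τ in Set.Icc (0 : ℝ) T, ENNReal.ofReal (K - τ)) +
          ∑ i ∈ Finset.range n, ∫⁻ τ in Set.Icc (0 : ℝ) T,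
            (Set.Ici ((π.t i ω).toReal + (d + dbar))).indicator
            (fun τ => ENNReal.ofReal (K + (π.t i ω).toReal - τ)) τ) := by
        have hsum := Finset.measurable_fun_sum (Finset.range n) fun i _ => hmeas i
        -- Only the correction terms have to be measurable in τ, not the age itself.
        rw [lintegral_add_right _ (Measurable.fun_add (by fun_prop) hsum),
          lintegral_add_left (by fun_prop), lintegral_finsetSum _ fun i _ => hmeas i]
        rfl
    _ ≤ _ := by
        gcongr
        · calc _ ≤ ∫⁻ τ in Set.Ici (0 : ℝ), ENNReal.ofReal (0 + K - τ) := by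
                rw [zero_add]; exact lintegral_mono_set Set.Icc_subset_Ici_self
            _ ≤ _ := setLIntegral_Ici_ofReal_sub_le 0 hK0
        · calc _ ≤ ∑ i ∈ Finset.range n, ENNReal.ofReal (c ^ 2 / 2) := by
                refine Finset.sum_le_sum fun i _ => ?_
                refine (setLIntegral_le_lintegral _ _).trans ?_
                rw [lintegral_indicator measurableSet_Ici]
                have heq : ∀ τ, K + (π.t i ω).toReal - τ = (π.t i ω).toReal + (d + dbar) + c - τ :=
                  fun τ => by rw [hK]; ring
                simp_rw [heq]
                exact setLIntegral_Ici_ofReal_sub_le _ hc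
            _ = _ := by simp

lemma mul_le_lintegral_area_add [MeasurableSpace Ω] {P : Measure Ω} [IsProbabilityMeasure P]
    (hd : 0 ≤ d) (hdbar : 0 ≤ dbar)
    (hdata : ∀ᵐ ω ∂P, ∀ i, π.t i ω + ENNReal.ofReal d ≤ π.tbar i ω)
    {N : Ω → ℕ} (hNm : Measurable N)
    (hN : ∀ᵐ ω ∂P, ∀ i, π.t i ω ≤ ENNReal.ofReal T → i < N ω) {c : ℝ} (hc : 0 ≤ c) :
    ENNReal.ofReal (d + dbar + c) * ENNReal.ofReal T ≤ ∫⁻ ω, π.area dbar T ω ∂P +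
      (ENNReal.ofReal ((d + dbar + c) ^ 2 / 2) +
        (∫⁻ ω, (N ω : ℝ≥0∞) ∂P) * ENNReal.ofReal (c ^ 2 / 2)) := by
  have hNm' : Measurable fun ω => (N ω : ℝ≥0∞) := by fun_prop
  calc _ = ∫⁻ _, ENNReal.ofReal (d + dbar + c) * ENNReal.ofReal T ∂P := by simp
    _ ≤ ∫⁻ ω, (π.area dbar T ω + (ENNReal.ofReal ((d + dbar + c) ^ 2 / 2) +
          N ω * ENNReal.ofReal (c ^ 2 / 2))) ∂P := by
        refine lintegral_mono_ae ?_
        filter_upwards [hdata, hN] with ω h1 h2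
        exact mul_le_area_add hd hdbar h1 h2 hc
    _ = _ := by
        rw [lintegral_add_right _ (by fun_prop), lintegral_add_right _ (by fun_prop),
          lintegral_mul_const _ hNm']
        simp

namespace IsFeasible

variable [MeasurableSpace Ω] {P : Measure Ω} {s sbar : ℕ → Ω → ℝ} {E Ebar : ℝ}

/-- Each of the updates 0, …, `i` costs one packet; the `+ 1` is the packet initially in the source
battery. -/
lemma lt_arrivals_add_one (h : π.IsFeasible P s sbar d dbar E Ebar)
    (hs : IsUnitPoissonProcess P s) (hE : 0 < E) (T : ℝ) :
    ∀ᵐ ω ∂P, ∀ i, π.t i ω ≤ ENNReal.ofReal T → i < arrivals (fun k => s k ω) 0 T + 1 := by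
  filter_upwards [h.data, h.halfDuplex, h.energy] with ω h1 h2 h3 i hi
  have hfin : π.t i ω ≠ ∞ := ne_top_of_le_ne_top ENNReal.ofReal_ne_top hi
  have h4 := h3 i hfin
  rw [batteryLevel_eq (hs.tendsto ω) E (fun j => π.t j ω) i
    (fun j _ => (le_self_add.trans (h1 j)).trans (le_self_add.trans (h2 j))) hfin] at h4
  have h5 : (i : ℝ) ≤ arrivals (fun k => s k ω) 0 (π.t i ω).toReal := by
    nlinarith
  rcases le_or_gt 0 T with hT | hT
  · have h6 := arrivals_mono_right (hs.tendsto ω) (a := 0)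
      (ENNReal.toReal_le_of_le_ofReal hT hi)
    have h7 : i ≤ arrivals (fun k => s k ω) 0 (π.t i ω).toReal := by exact_mod_cast h5
    exact Nat.lt_succ_of_le (h7.trans h6)
  -- For negative `T` the bound degenerates to `t i = 0`, before which nothing has arrived, so `i =
  -- 0`.
  · rw [ENNReal.ofReal_of_nonpos hT.le, nonpos_iff_eq_zero] at hi
    rw [hi, ENNReal.toReal_zero, arrivals_self] at h5
    have : i ≤ 0 := by exact_mod_cast h5
    omega

/-- Successive source transmissions are at least `d + dbar` apart, so `t i ≥ i * (d + dbar)`. -/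
lemma lt_floor_add_one (h : π.IsFeasible P s sbar d dbar E Ebar) (hd : 0 < d) (hdbar : 0 < dbar)
    (hT : 0 ≤ T) :
    ∀ᵐ ω ∂P, ∀ i, π.t i ω ≤ ENNReal.ofReal T → i < ⌊T / (d + dbar)⌋₊ + 1 := by
  filter_upwards [h.data, h.halfDuplex] with ω h1 h2 i hi
  have hge : ∀ i : ℕ, ENNReal.ofReal (i * (d + dbar)) ≤ π.t i ω := by
    intro i
    induction i with
    | zero => simp
    | succ i ih =>
      calc ENNReal.ofReal (((i + 1 : ℕ) : ℝ) * (d + dbar))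
          = ENNReal.ofReal (i * (d + dbar)) + ENNReal.ofReal d + ENNReal.ofReal dbar := by
            rw [← ENNReal.ofReal_add (by positivity) hd.le,
              ← ENNReal.ofReal_add (by positivity) hdbar.le]
            push_cast
            congr 1
            ring
        _ ≤ π.t i ω + ENNReal.ofReal d + ENNReal.ofReal dbar := by gcongr
        _ ≤ π.tbar i ω + ENNReal.ofReal dbar := by gcongr; exact h1 i
        _ ≤ _ := h2 i
  have h3 := (ENNReal.ofReal_le_ofReal_iff hT).1 ((hge i).trans hi)
  rw [Nat.lt_succ_iff, Nat.le_floor_iff (by positivity), le_div_iff₀ (by positivity)]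
  exact h3

lemma mul_le_lintegral_area_add_max [IsProbabilityMeasure P]
    (h : π.IsFeasible P s sbar d dbar E Ebar)
    (hs : IsUnitPoissonProcess P s) (hd : 0 < d) (hdbar : 0 < dbar) (hE : 0 < E) (hT : 0 ≤ T)
    {L : ℝ} (hL : L = max 1 (d + dbar)) :
    ENNReal.ofReal ((d + dbar + L) * T) ≤ ∫⁻ ω, π.area dbar T ω ∂P +
      ENNReal.ofReal ((d + dbar + L) ^ 2 / 2 + (1 + T / L) * (L ^ 2 / 2)) := by
  have hL0 : 0 < L := by rw [hL]; positivity
  have hN : ∃ N : Ω → ℕ, Measurable N ∧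
      (∀ᵐ ω ∂P, ∀ i, π.t i ω ≤ ENNReal.ofReal T → i < N ω) ∧
      ∫⁻ ω, (N ω : ℝ≥0∞) ∂P ≤ ENNReal.ofReal (1 + T / L) := by
    -- The binding constraint is the one attaining the maximum: the service time if `d + dbar ≥ 1`,
    -- the energy supply otherwise.
    rcases le_total 1 (d + dbar) with h1 | h1
    · refine ⟨_, measurable_const, h.lt_floor_add_one hd hdbar hT, ?_⟩
      rw [lintegral_const, measure_univ, mul_one, ← ENNReal.ofReal_natCast, hL, max_eq_right h1]
      refine ENNReal.ofReal_le_ofReal ?_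
      push_cast
      linarith [Nat.floor_le (show 0 ≤ T / (d + dbar) by positivity)]
    · refine ⟨fun ω => arrivals (fun k => s k ω) 0 T + 1,
        (hs.measurable_arrivals_zero T).add_const 1, h.lt_arrivals_add_one hs hE T, ?_⟩
      push_cast
      rw [lintegral_add_right _ measurable_const, hs.lintegral_arrivals hT, hL, max_eq_left h1,
        div_one, add_comm 1 T, ENNReal.ofReal_add hT zero_le_one]
      simp
  obtain ⟨N, hNm, hN, hNle⟩ := hN
  rw [ENNReal.ofReal_mul (by positivity), ENNReal.ofReal_add (p := (d + dbar + L) ^ 2 / 2) (by positivity) (by positivity),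
    ENNReal.ofReal_mul (p := 1 + T / L) (by positivity)]
  refine (mul_le_lintegral_area_add hd.le hdbar.le h.data hNm hN hL0.le).trans ?_
  gcongr

/-- No feasible policy has a smaller long-term average age. -/
theorem le_longTermAoI [IsProbabilityMeasure P]
    (h : π.IsFeasible P s sbar d dbar E Ebar)
    (hs : IsUnitPoissonProcess P s) (hd : 0 < d) (hdbar : 0 < dbar) (hE : 0 < E)
    {L : ℝ} (hL : L = max 1 (d + dbar)) :
    ENNReal.ofReal (d + dbar + L / 2) ≤ π.longTermAoI P dbar := by
  have hL0 : 0 < L := by rw [hL]; positivity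
  -- The part of the loss that does not grow with `T`: the initial triangle and the extra update in
  -- `1 + T / L`.
  set C := (d + dbar + L) ^ 2 / 2 + L ^ 2 / 2
  have hlim : Tendsto (fun T : ℝ => ENNReal.ofReal (d + dbar + L / 2 - C / T)) atTop
      (nhds (ENNReal.ofReal (d + dbar + L / 2))) := by
    refine ENNReal.tendsto_ofReal ?_
    simpa using (tendsto_const_nhds (x := d + dbar + L / 2)).sub
      (tendsto_const_nhds (x := C).div_atTop tendsto_id)
  rw [← hlim.limsup_eq]
  refine limsup_le_limsup ?_
  filter_upwards [eventually_gt_atTop 0] with T hT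
  rw [ENNReal.le_div_iff_mul_le (Or.inl (by simpa using hT)) (Or.inl ENNReal.ofReal_ne_top),
    ← ENNReal.ofReal_mul' hT.le]
  have key := h.mul_le_lintegral_area_add_max hs hd hdbar hE hT.le hL
  have heq : (d + dbar + L / 2 - C / T) * T =
      (d + dbar + L) * T - ((d + dbar + L) ^ 2 / 2 + (1 + T / L) * (L ^ 2 / 2)) := by
    simp only [C]
    field_simp
    ring
  rw [heq, ENNReal.ofReal_sub _ (by positivity)]
  exact tsub_le_iff_right.2 key

end IsFeasible

end Policy

/-! ### The best-effort policy is feasible and online -/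

section

section Pathwise

variable {d dbar E Ebar : ℝ} {s sbar : ℕ → ℝ}

lemma slot_mono : Monotone (slot d dbar) := fun m n h => by
  unfold slot
  have : (m : ℝ) ≤ n := by exact_mod_cast h
  gcongr

lemma slot_nonneg (n : ℕ) : 0 ≤ slot d dbar n := by unfold slot; positivity

lemma slot_zero : slot d dbar 0 = 0 := by simp [slot]

lemma slot_add_le {m n : ℕ} (h : m < n) : slot d dbar m + (d + dbar) ≤ slot d dbar n := by
  have h1 : slot d dbar m + max 1 (d + dbar) = slot d dbar (m + 1) := by
    unfold slot; push_cast; ring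
  linarith [le_max_right 1 (d + dbar), slot_mono (d := d) (dbar := dbar) (Nat.succ_le_of_lt h)]

open Classical in
lemma bestEffortBatteries_eq (hs : Tendsto s atTop atTop) (hsbar : Tendsto sbar atTop atTop)
    (n : ℕ) :
    bestEffortBatteries d dbar E Ebar s sbar n =
      (E + E * arrivals s 0 (slot d dbar n)
          - Nat.count (BestEffortSends d dbar E Ebar s sbar) n * E,
        Ebar + Ebar * arrivals sbar 0 (slot d dbar n)
          - Nat.count (BestEffortSends d dbar E Ebar s sbar) n * Ebar) := by
  induction n with
  | zero => simp [bestEffortBatteries, slot_zero, arrivals_self]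
  | succ n ih =>
    have hle := slot_mono (d := d) (dbar := dbar) n.le_succ
    have h1 := arrivals_add hs (slot_nonneg (d := d) (dbar := dbar) n) hle
    have h2 := arrivals_add hsbar (slot_nonneg (d := d) (dbar := dbar) n) hle
    rw [← h1, ← h2, Nat.count_succ]
    by_cases h : BestEffortSends d dbar E Ebar s sbar n
    · have h' := h
      rw [BestEffortSends] at h'
      rw [bestEffortBatteries, if_pos h, if_pos h', ih]
      ext <;> push_cast <;> ring
    · have h' := h
      rw [BestEffortSends] at h'
      rw [bestEffortBatteries, if_neg h, if_neg h', ih]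
      ext <;> push_cast <;> ring

open Classical in
-- The packet sizes cancel: a node can send exactly when its past transmissions do not exceed its
-- arrivals, the initial packet paying for the present one.
lemma bestEffortSends_iff (hs : Tendsto s atTop atTop) (hsbar : Tendsto sbar atTop atTop)
    (hE : 0 < E) (hEbar : 0 < Ebar) (n : ℕ) :
    BestEffortSends d dbar E Ebar s sbar n ↔
      Nat.count (BestEffortSends d dbar E Ebar s sbar) n ≤ arrivals s 0 (slot d dbar n) ∧
      Nat.count (BestEffortSends d dbar E Ebar s sbar) n ≤ arrivals sbar 0 (slot d dbar n) := by
  have key : ∀ {e : ℝ}, 0 < e → ∀ a c : ℕ, e ≤ e + e * a - c * e ↔ c ≤ a := by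
    intro e he a c
    rw [← Nat.cast_le (α := ℝ)]
    constructor
    · intro h
      nlinarith
    · intro h
      nlinarith
  rw [← key hE, ← key hEbar]
  conv_lhs => rw [BestEffortSends, bestEffortBatteries_eq hs hsbar]

lemma bestEffortSends_zero : BestEffortSends d dbar E Ebar s sbar 0 := by
  simp [BestEffortSends, bestEffortBatteries]

open Classical in
lemma bestEffortTime_eq {n i : ℕ} (h : BestEffortSends d dbar E Ebar s sbar n)
    (hi : Nat.count (BestEffortSends d dbar E Ebar s sbar) n = i) :
    bestEffortTime d dbar E Ebar s sbar i = ENNReal.ofReal (slot d dbar n) := by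
  refine le_antisymm (iInf₂_le n ⟨h, hi⟩) (le_iInf₂ fun m hm => ?_)
  rw [Nat.count_injective hm.1 h (hm.2.trans hi.symm)]

open Classical in
lemma exists_of_bestEffortTime_ne_top {i : ℕ} (h : bestEffortTime d dbar E Ebar s sbar i ≠ ∞) :
    ∃ n, BestEffortSends d dbar E Ebar s sbar n ∧
      Nat.count (BestEffortSends d dbar E Ebar s sbar) n = i ∧
      bestEffortTime d dbar E Ebar s sbar i = ENNReal.ofReal (slot d dbar n) := by
  by_contra hcon
  push Not at hcon
  refine h (iInf₂_eq_top.2 fun n hn => ?_)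
  exact absurd (bestEffortTime_eq hn.1 hn.2) (hcon n hn.1 hn.2)

open Classical in
lemma bestEffortTime_le_iff {i : ℕ} {u : ℝ} (hu : 0 ≤ u) :
    bestEffortTime d dbar E Ebar s sbar i ≤ ENNReal.ofReal u ↔
      ∃ n, slot d dbar n ≤ u ∧ BestEffortSends d dbar E Ebar s sbar n ∧
        Nat.count (BestEffortSends d dbar E Ebar s sbar) n = i := by
  constructor
  · intro h
    obtain ⟨n, h1, h2, h3⟩ :=
      exists_of_bestEffortTime_ne_top (ne_top_of_le_ne_top ENNReal.ofReal_ne_top h)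
    rw [h3] at h
    exact ⟨n, (ENNReal.ofReal_le_ofReal_iff hu).1 h, h1, h2⟩
  · rintro ⟨n, h1, h2, h3⟩
    rw [bestEffortTime_eq h2 h3]
    exact ENNReal.ofReal_le_ofReal h1

lemma bestEffortTime_add_le_succ (hd : 0 < d) (hdbar : 0 < dbar) (i : ℕ) :
    bestEffortTime d dbar E Ebar s sbar i + ENNReal.ofReal d + ENNReal.ofReal dbar ≤
      bestEffortTime d dbar E Ebar s sbar (i + 1) := by
  classical
  by_cases htop : bestEffortTime d dbar E Ebar s sbar (i + 1) = ∞
  · rw [htop]; exact le_top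
  obtain ⟨n, h1, h2, h3⟩ := exists_of_bestEffortTime_ne_top htop
  -- Since `i + 1` slots before `n` were used, the one with index `i` among them (`Nat.nth`) lies
  -- before `n`.
  obtain ⟨m, hmn, hm1, hm2⟩ : ∃ m < n, BestEffortSends d dbar E Ebar s sbar m ∧
      Nat.count (BestEffortSends d dbar E Ebar s sbar) m = i := by
    have hlt : i < Nat.count (BestEffortSends d dbar E Ebar s sbar) n := by omega
    refine ⟨_, Nat.nth_lt_of_lt_count hlt, Nat.nth_mem _ fun hf => ?_,
      Nat.count_nth fun hf => ?_⟩ <;> exact hlt.trans_le (Nat.count_le_card hf n)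
  have hm0 := slot_nonneg (d := d) (dbar := dbar) m
  rw [bestEffortTime_eq hm1 hm2, h3, ← ENNReal.ofReal_add hm0 hd.le,
    ← ENNReal.ofReal_add (by positivity) hdbar.le, add_assoc]
  exact ENNReal.ofReal_le_ofReal (slot_add_le hmn)

lemma bestEffortTime_monotone (hd : 0 < d) (hdbar : 0 < dbar) (i : ℕ) :
    bestEffortTime d dbar E Ebar s sbar i ≤ bestEffortTime d dbar E Ebar s sbar (i + 1) :=
  (le_self_add.trans le_self_add).trans (bestEffortTime_add_le_succ hd hdbar i)

end Pathwise

variable {Ω : Type*} {s sbar : ℕ → Ω → ℝ} {d dbar E Ebar : ℝ}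

/-- The history records only counts from time 0; a count on `[a, b)` is the difference of two of
them. -/
lemma measurable_arrivals_history (hs : ∀ ω, Tendsto (fun k => s k ω) atTop atTop) {a b u : ℝ}
    (ha : 0 ≤ a) (hab : a ≤ b) (hbu : b ≤ u) :
    Measurable[history s sbar u] fun ω => arrivals (fun k => s k ω) a b := by
  have h0 : ∀ v, 0 ≤ v → v ≤ u →
      Measurable[history s sbar u] fun ω => arrivals (fun k => s k ω) 0 v := fun v h1 h2 =>
    measurable_iff_comap_le.2 (le_trans le_sup_left
      (le_iSup (fun v : Set.Icc (0 : ℝ) u =>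
        (MeasurableSpace.comap (fun ω => arrivals (fun k => s k ω) 0 v) ⊤ ⊔
          MeasurableSpace.comap (fun ω => arrivals (fun k => sbar k ω) 0 v) ⊤)) ⟨v, h1, h2⟩))
  have heq : (fun ω => arrivals (fun k => s k ω) a b) =
      (fun p : ℕ × ℕ => p.1 - p.2) ∘
        fun ω => (arrivals (fun k => s k ω) 0 b, arrivals (fun k => s k ω) 0 a) := by
    funext ω
    rw [Function.comp_apply, ← arrivals_add (hs ω) ha hab, Nat.add_sub_cancel_left]
  rw [heq]
  exact (Measurable.of_discrete).comp
    ((h0 b (ha.trans hab) hbu).prodMk (h0 a ha (hab.trans hbu)))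

lemma history_comm (u : ℝ) : history s sbar u = history sbar s u := by
  unfold history
  simp_rw [sup_comm]

open Classical in
lemma measurable_bestEffortBatteries (hs : ∀ ω, Tendsto (fun k => s k ω) atTop atTop)
    (hsbar : ∀ ω, Tendsto (fun k => sbar k ω) atTop atTop) {u : ℝ} {n : ℕ}
    (hn : slot d dbar n ≤ u) :
    Measurable[history s sbar u] fun ω =>
      bestEffortBatteries d dbar E Ebar (fun k => s k ω) (fun k => sbar k ω) n := by
  let _ : MeasurableSpace Ω := history s sbar u
  induction n with
  | zero => exact measurable_const
  | succ n ih =>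
    have hle := slot_mono (d := d) (dbar := dbar) n.le_succ
    have ih := ih (hle.trans hn)
    have h1 := measurable_arrivals_history (sbar := sbar) hs (slot_nonneg n) hle hn
    have h2 := measurable_arrivals_history (sbar := s) hsbar (slot_nonneg n) hle hn
    rw [history_comm] at h2
    have hset : MeasurableSet {ω | E ≤ (bestEffortBatteries d dbar E Ebar (fun k => s k ω)
        (fun k => sbar k ω) n).1 ∧ Ebar ≤ (bestEffortBatteries d dbar E Ebar (fun k => s k ω)
        (fun k => sbar k ω) n).2} :=
      (measurableSet_le measurable_const ih.fst).inter (measurableSet_le measurable_const ih.snd)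
    have hr : Measurable fun ω =>
        if E ≤ (bestEffortBatteries d dbar E Ebar (fun k => s k ω) (fun k => sbar k ω) n).1 ∧
          Ebar ≤ (bestEffortBatteries d dbar E Ebar (fun k => s k ω) (fun k => sbar k ω) n).2
        then
          ((bestEffortBatteries d dbar E Ebar (fun k => s k ω) (fun k => sbar k ω) n).1 - E,
            (bestEffortBatteries d dbar E Ebar (fun k => s k ω) (fun k => sbar k ω) n).2 - Ebar)
        else bestEffortBatteries d dbar E Ebar (fun k => s k ω) (fun k => sbar k ω) n :=
      Measurable.ite hset ((ih.fst.sub_const E).prodMk (ih.snd.sub_const Ebar)) ih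
    have c1 : Measurable fun ω => E * (arrivals (fun k => s k ω) (slot d dbar n)
        (slot d dbar (n + 1)) : ℝ) := (measurable_from_nat.comp h1).const_mul E
    have c2 : Measurable fun ω => Ebar * (arrivals (fun k => sbar k ω) (slot d dbar n)
        (slot d dbar (n + 1)) : ℝ) := (measurable_from_nat.comp h2).const_mul Ebar
    exact (hr.fst.add c1).prodMk (hr.snd.add c2)

lemma measurableSet_bestEffortSends (hs : ∀ ω, Tendsto (fun k => s k ω) atTop atTop)
    (hsbar : ∀ ω, Tendsto (fun k => sbar k ω) atTop atTop) {u : ℝ} {n : ℕ}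
    (hn : slot d dbar n ≤ u) :
    MeasurableSet[history s sbar u]
      {ω | BestEffortSends d dbar E Ebar (fun k => s k ω) (fun k => sbar k ω) n} := by
  let _ : MeasurableSpace Ω := history s sbar u
  have ih := measurable_bestEffortBatteries (E := E) (Ebar := Ebar) hs hsbar hn
  exact (measurableSet_le measurable_const ih.fst).inter (measurableSet_le measurable_const ih.snd)

open Classical in
lemma measurable_count_bestEffortSends (hs : ∀ ω, Tendsto (fun k => s k ω) atTop atTop)
    (hsbar : ∀ ω, Tendsto (fun k => sbar k ω) atTop atTop) {u : ℝ} {n : ℕ}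
    (hn : slot d dbar n ≤ u) :
    Measurable[history s sbar u] fun ω =>
      Nat.count (BestEffortSends d dbar E Ebar (fun k => s k ω) (fun k => sbar k ω)) n := by
  let _ : MeasurableSpace Ω := history s sbar u
  induction n with
  | zero => simp_rw [Nat.count_zero]; exact measurable_const
  | succ n ih =>
    have hle := (slot_mono (d := d) (dbar := dbar) n.le_succ).trans hn
    simp_rw [Nat.count_succ]
    exact (ih hle).add (Measurable.ite (measurableSet_bestEffortSends hs hsbar hle)
      measurable_const measurable_const)

/-- Two times are needed for the relay: its event at time `u` is the source event at `u - d`, to be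
decided by the history up to `u`. -/
lemma measurableSet_bestEffortTime_le (hs : ∀ ω, Tendsto (fun k => s k ω) atTop atTop)
    (hsbar : ∀ ω, Tendsto (fun k => sbar k ω) atTop atTop) {u v : ℝ} (hu : 0 ≤ u) (huv : u ≤ v)
    (i : ℕ) : MeasurableSet[history s sbar v]
      {ω | bestEffortTime d dbar E Ebar (fun k => s k ω) (fun k => sbar k ω) i
        ≤ ENNReal.ofReal u} := by
  classical
  let _ : MeasurableSpace Ω := history s sbar v
  simp_rw [bestEffortTime_le_iff hu, Set.ofPred_exists]
  refine MeasurableSet.iUnion fun n => ?_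
  by_cases hn : slot d dbar n ≤ u
  · simp only [hn, true_and]
    exact (measurableSet_bestEffortSends hs hsbar (hn.trans huv)).inter
      (measurable_count_bestEffortSends hs hsbar (hn.trans huv) (measurableSet_singleton i))
  · simp [hn]

theorem bestEffort_isOnline (hs : ∀ ω, Tendsto (fun k => s k ω) atTop atTop)
    (hsbar : ∀ ω, Tendsto (fun k => sbar k ω) atTop atTop) (hd : 0 < d) :
    (bestEffort d dbar E Ebar s sbar).IsOnline s sbar := by
  intro i u hu
  refine ⟨measurableSet_bestEffortTime_le hs hsbar hu le_rfl i, ?_⟩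
  let _ : MeasurableSpace Ω := history s sbar u
  rcases le_or_gt d u with hdu | hdu
  · have : {ω | (bestEffort d dbar E Ebar s sbar).tbar i ω ≤ ENNReal.ofReal u} =
        {ω | bestEffortTime d dbar E Ebar (fun k => s k ω) (fun k => sbar k ω) i
          ≤ ENNReal.ofReal (u - d)} := by
      ext ω
      simp only [bestEffort, Set.mem_ofPred_eq]
      rw [ENNReal.ofReal_sub _ hd.le, ENNReal.le_sub_iff_add_le_right ENNReal.ofReal_ne_top
        (ENNReal.ofReal_le_ofReal hdu)]
    rw [this]
    exact measurableSet_bestEffortTime_le hs hsbar (sub_nonneg.2 hdu) (by linarith) i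
  · have : {ω | (bestEffort d dbar E Ebar s sbar).tbar i ω ≤ ENNReal.ofReal u} = ∅ := by
      ext ω
      simp only [bestEffort, Set.mem_ofPred_eq, Set.mem_empty_iff_false, iff_false, not_le]
      exact ((ENNReal.ofReal_lt_ofReal_iff hd).2 hdu).trans_le le_add_self
    rw [this]
    exact MeasurableSet.empty

variable [MeasurableSpace Ω] {P : Measure Ω}

theorem bestEffort_isFeasible (hs : IsUnitPoissonProcess P s)
    (hsbar : IsUnitPoissonProcess P sbar) (hd : 0 < d) (hdbar : 0 < dbar)
    (hEbar : 0 < Ebar) :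
    (bestEffort d dbar E Ebar s sbar).IsFeasible P s sbar d dbar E Ebar := by
  classical
  have hmeas : ∀ i, Measurable ((bestEffort d dbar E Ebar s sbar).t i) := by
    intro i
    refine Measurable.iInf fun n => ?_
    have hset : MeasurableSet {ω | BestEffortSends d dbar E Ebar (fun k => s k ω)
        (fun k => sbar k ω) n ∧ Nat.count (BestEffortSends d dbar E Ebar (fun k => s k ω)
        (fun k => sbar k ω)) n = i} :=
      hs.history_le hsbar (slot d dbar n) _
        (@MeasurableSet.inter _ (history s sbar (slot d dbar n)) _ _
          (measurableSet_bestEffortSends hs.tendsto hsbar.tendsto le_rfl)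
          (measurable_count_bestEffortSends hs.tendsto hsbar.tendsto le_rfl
            (measurableSet_singleton i)))
    simp_rw [iInf_eq_if]
    exact Measurable.ite hset measurable_const measurable_const
  refine ⟨hmeas, fun i => (hmeas i).add_const _, .of_forall fun ω i => le_rfl,
    .of_forall fun ω i => bestEffortTime_add_le_succ hd hdbar i, .of_forall fun ω i hi => ?_,
    .of_forall fun ω i hi => ?_⟩
  · obtain ⟨n, h1, h2, h3⟩ := exists_of_bestEffortTime_ne_top hi
    rw [batteryLevel_eq (hs.tendsto ω) _ (fun j => (bestEffort d dbar E Ebar s sbar).t j ω) _ (fun j _ => bestEffortTime_monotone hd hdbar j) hi]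
    simp only [bestEffort, h3, ENNReal.toReal_ofReal (slot_nonneg (d := d) (dbar := dbar) n)]
    have h4 := h1.1
    rw [bestEffortBatteries_eq (hs.tendsto ω) (hsbar.tendsto ω), h2] at h4
    exact h4
  · have hi' : bestEffortTime d dbar E Ebar (fun k => s k ω) (fun k => sbar k ω) i ≠ ∞ :=
      ne_top_of_le_ne_top hi le_self_add
    obtain ⟨n, h1, h2, h3⟩ := exists_of_bestEffortTime_ne_top hi'
    rw [batteryLevel_eq (hsbar.tendsto ω) _ (fun j => (bestEffort d dbar E Ebar s sbar).tbar j ω) _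
      (fun j _ => add_le_add (bestEffortTime_monotone hd hdbar j) le_rfl) hi]
    simp only [bestEffort, h3]
    rw [← ENNReal.ofReal_add (slot_nonneg n) hd.le,
      ENNReal.toReal_ofReal (add_nonneg (slot_nonneg n) hd.le)]
    have h4 := h1.2
    rw [bestEffortBatteries_eq (hs.tendsto ω) (hsbar.tendsto ω), h2] at h4
    -- The relay's energy was checked at the slot; by the time it forwards, `d` later, its battery
    -- can only have gained.
    have h5 : (arrivals (fun k => sbar k ω) 0 (slot d dbar n) : ℝ) ≤
        arrivals (fun k => sbar k ω) 0 (slot d dbar n + d) := by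
      exact_mod_cast arrivals_mono_right (hsbar.tendsto ω) (by linarith)
    have h6 := mul_le_mul_of_nonneg_left h5 hEbar.le
    simp only at h4
    linarith

end

/-! ### Missed slots are rare, and idle periods are short on average -/

section

/-- Averages of triangular arrays: if the row entries are dominated by a summable sequence and by
shifts of a sequence with vanishing averages, then the row sums have vanishing averages. -/
lemma tendsto_average_triangular {a : ℕ → ℕ → ℝ} {p q : ℕ → ℝ} (ha : ∀ n k, 0 ≤ a n k)
    (hp0 : ∀ j, 0 ≤ p j) (hq : Summable q) (h1 : ∀ n k, k < n → a n k ≤ p (n - k))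
    (h2 : ∀ n k, k < n → a n k ≤ q k)
    (hp : Tendsto (fun N : ℕ => (∑ j ∈ Finset.range N, p j) / N) atTop (nhds 0)) :
    Tendsto (fun N : ℕ => (∑ n ∈ Finset.range N, ∑ k ∈ Finset.range n, a n k) / N)
      atTop (nhds 0) := by
  have hq0 : ∀ k, 0 ≤ q k := fun k => (ha (k + 1) k).trans (h2 _ _ k.lt_succ_self)
  -- Exchange the sums, so that dominated convergence applies to the series over `k`: for fixed `k`
  -- the column average vanishes because of `p`, and it is dominated by `q k`.
  set b : ℕ → ℕ → ℝ := fun N k => (∑ n ∈ Finset.range N, if k < n then a n k else 0) / N with hb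
  have hb0 : ∀ N k, 0 ≤ b N k := fun N k =>
    div_nonneg (Finset.sum_nonneg fun n _ => by split_ifs <;> simp [ha]) (Nat.cast_nonneg N)
  have hsum : ∀ N, ∑' k, b N k =
      (∑ n ∈ Finset.range N, ∑ k ∈ Finset.range n, a n k) / N := by
    intro N
    rw [tsum_eq_sum (s := Finset.range N)]
    · simp only [hb]
      rw [← Finset.sum_div, Finset.sum_comm]
      congr 1
      refine Finset.sum_congr rfl fun n hn => ?_
      rw [← Finset.sum_filter]
      congr 1
      ext k
      simp only [Finset.mem_filter, Finset.mem_range] at hn ⊢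
      omega
    · intro k hk
      simp only [hb, Finset.mem_range] at hk ⊢
      rw [Finset.sum_eq_zero, zero_div]
      intro n hn
      rw [if_neg]
      have := Finset.mem_range.1 hn
      omega
  simp_rw [← hsum]
  have := tendsto_tsum_of_dominated_convergence (𝓕 := atTop) (f := b) (g := fun _ => (0 : ℝ)) hq
    (fun k => ?_) (.of_forall fun N k => ?_)
  · simpa using this
  · refine squeeze_zero (fun N => hb0 N k) (fun N => ?_) hp
    refine div_le_div_of_nonneg_right ?_ (Nat.cast_nonneg N)
    rw [← Finset.sum_filter]
    calc _ ≤ ∑ n ∈ Finset.range N with k < n, p (n - k) :=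
          Finset.sum_le_sum fun n hn => h1 n k (Finset.mem_filter.1 hn).2
      _ = ∑ j ∈ {n ∈ Finset.range N | k < n}.image (· - k), p j := by
          rw [Finset.sum_image]
          intro x hx y hy hxy
          simp only [Finset.coe_filter, Finset.mem_range, Set.mem_ofPred_eq] at hx hy hxy
          omega
      _ ≤ _ := by
          refine Finset.sum_le_sum_of_subset_of_nonneg (fun j hj => ?_) fun j _ _ => hp0 j
          simp only [Finset.mem_image, Finset.mem_filter, Finset.mem_range] at hj ⊢
          omega
  · rw [Real.norm_of_nonneg (hb0 N k)]
    rcases N.eq_zero_or_pos with rfl | hN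
    · simp [hb, hq0 k]
    rw [hb, div_le_iff₀ (by positivity)]
    calc _ ≤ ∑ n ∈ Finset.range N, q k := Finset.sum_le_sum fun n _ => by
          split_ifs with h
          · exact h2 n k h
          · exact hq0 k
      _ = _ := by simp [mul_comm]

section Pathwise

variable {d dbar E Ebar : ℝ} {s sbar : ℕ → ℝ}

open Classical in
-- The count grows only when it does not exceed the arrivals at either node, and then by one.
lemma count_bestEffortSends_le (hs : Tendsto s atTop atTop) (hsbar : Tendsto sbar atTop atTop)
    (hE : 0 < E) (hEbar : 0 < Ebar) (n : ℕ) :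
    Nat.count (BestEffortSends d dbar E Ebar s sbar) n ≤ arrivals s 0 (slot d dbar n) + 1 ∧
    Nat.count (BestEffortSends d dbar E Ebar s sbar) n ≤ arrivals sbar 0 (slot d dbar n) + 1 := by
  induction n with
  | zero => simp
  | succ n ih =>
    have hle : slot d dbar n ≤ slot d dbar (n + 1) := slot_mono n.le_succ
    have h1 := arrivals_mono_right hs (a := 0) hle
    have h2 := arrivals_mono_right hsbar (a := 0) hle
    rw [Nat.count_succ]
    split_ifs with h
    · rw [bestEffortSends_iff hs hsbar hE hEbar] at h
      constructor <;> omega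
    · constructor <;> omega

/-- During an idle period the count is frozen. If slot `n` is missed, some node has fewer arrivals
up to `n` than this count, which is at most one more than its arrivals up to `m`; so that node
received nothing in between. -/
lemma arrivals_eq_zero_of_idle (hs : Tendsto s atTop atTop) (hsbar : Tendsto sbar atTop atTop)
    (hE : 0 < E) (hEbar : 0 < Ebar) {m n : ℕ} (hmn : m ≤ n)
    (h : ∀ j, m ≤ j → j ≤ n → ¬ BestEffortSends d dbar E Ebar s sbar j) :
    arrivals s (slot d dbar m) (slot d dbar n) = 0 ∨
      arrivals sbar (slot d dbar m) (slot d dbar n) = 0 := by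
  classical
  have hcount : ∀ j, m ≤ j → j ≤ n → Nat.count (BestEffortSends d dbar E Ebar s sbar) j =
      Nat.count (BestEffortSends d dbar E Ebar s sbar) m := by
    intro j hmj
    induction j, hmj using Nat.le_induction with
    | base => exact fun _ => rfl
    | succ j hmj ih =>
      intro hj
      rw [Nat.count_succ, if_neg (h j hmj (by omega)), ih (by omega), add_zero]
  have h1 := h n hmn le_rfl
  rw [bestEffortSends_iff hs hsbar hE hEbar, hcount n hmn le_rfl] at h1
  have h2 := count_bestEffortSends_le (d := d) (dbar := dbar) hs hsbar hE hEbar m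
  have h3 := arrivals_add hs (slot_nonneg m) (slot_mono (d := d) (dbar := dbar) hmn)
  have h4 := arrivals_add hsbar (slot_nonneg m) (slot_mono (d := d) (dbar := dbar) hmn)
  omega

open Classical in
/-- If the arrivals keep up with the schedule on average, then the frequency of the missed
updates tends to zero. -/
lemma tendsto_missed_div (hs : Tendsto s atTop atTop) (hsbar : Tendsto sbar atTop atTop)
    (hE : 0 < E) (hEbar : 0 < Ebar) {L : ℝ} (hL : 1 ≤ L)
    (h1 : Tendsto (fun n : ℕ => (arrivals s 0 (slot d dbar n) : ℝ) / n) atTop (nhds L))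
    (h2 : Tendsto (fun n : ℕ => (arrivals sbar 0 (slot d dbar n) : ℝ) / n) atTop (nhds L)) :
    Tendsto (fun n : ℕ => ((n : ℝ) - Nat.count (BestEffortSends d dbar E Ebar s sbar) n) / n)
      atTop (nhds 0) := by
  set c := Nat.count (BestEffortSends d dbar E Ebar s sbar) with hc
  have hcn : ∀ n, c n ≤ n := fun n => Nat.count_le _
  have hcn' : ∀ n, (c n : ℝ) ≤ n := fun n => by exact_mod_cast hcn n
  rw [Metric.tendsto_atTop]
  intro ε hε
  have hev : ∀ᶠ n : ℕ in atTop, (1 - ε / 2) * n ≤ arrivals s 0 (slot d dbar n) ∧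
      (1 - ε / 2) * n ≤ arrivals sbar 0 (slot d dbar n) := by
    filter_upwards [h1.eventually_const_lt (show 1 - ε / 2 < L by linarith),
      h2.eventually_const_lt (show 1 - ε / 2 < L by linarith), eventually_gt_atTop 0]
      with n h3 h4 hn
    have hn' : (0 : ℝ) < n := by exact_mod_cast hn
    exact ⟨((lt_div_iff₀ hn').1 h3).le, ((lt_div_iff₀ hn').1 h4).le⟩
  obtain ⟨J, hJ⟩ := eventually_atTop.1 hev
  -- A miss at `n ≥ J` means that the count exceeds the arrivals at some node, hence exceeds `(1 - ε
  -- / 2) * n`; so the number of misses before it is below `ε / 2 * n`, and the new miss fits into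
  -- the `+ 1`. Before `J` the trivial bound by the number of slots suffices.
  have hbound : ∀ n : ℕ, (n : ℝ) - c n ≤ J + 1 + ε / 2 * n := by
    intro n
    induction n with
    | zero => simp [hc]; positivity
    | succ n ih =>
      have hsucc : c (n + 1) = c n + if BestEffortSends d dbar E Ebar s sbar n then 1 else 0 :=
        Nat.count_succ _ _
      rw [hsucc]
      split_ifs with h
      · push_cast
        linarith
      · push_cast
        rcases lt_or_ge n J with hn | hn
        · have : (n : ℝ) + 1 ≤ J := by exact_mod_cast hn
          have := (c n).cast_nonneg (α := ℝ)
          have : 0 ≤ ε / 2 * ((n : ℝ) + 1) := by positivity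
          linarith
        · rw [bestEffortSends_iff hs hsbar hE hEbar, not_and_or, not_le, not_le,
            ← Nat.cast_lt (α := ℝ), ← Nat.cast_lt (α := ℝ)] at h
          have h3 := hJ n hn
          have h4 : (1 - ε / 2) * n < c n := by
            rcases h with h | h
            · exact h3.1.trans_lt h
            · exact h3.2.trans_lt h
          have := J.cast_nonneg (α := ℝ)
          linarith
  obtain ⟨N, hN⟩ := exists_nat_gt (((J : ℝ) + 1) / (ε / 2))
  refine ⟨N + 1, fun n hn => ?_⟩
  have hn' : (N : ℝ) + 1 ≤ n := by exact_mod_cast hn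
  have hn0 : (0 : ℝ) < n := by linarith [N.cast_nonneg (α := ℝ)]
  rw [Real.dist_eq, sub_zero, abs_of_nonneg (div_nonneg (sub_nonneg.2 (hcn' n)) hn0.le),
    div_lt_iff₀ hn0]
  have h5 := (div_lt_iff₀ (by positivity)).1 hN
  have h6 := hbound n
  nlinarith

end Pathwise

variable {Ω : Type*} {s sbar : ℕ → Ω → ℝ} {d dbar E Ebar : ℝ} [MeasurableSpace Ω] {P : Measure Ω}

namespace IsUnitPoissonProcess

lemma integrable_arrivals (hs : IsUnitPoissonProcess P s) {T : ℝ} (hT : 0 ≤ T) :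
    Integrable (fun ω => (arrivals (fun k => s k ω) 0 T : ℝ)) P := by
  have h := integrable_toReal_of_lintegral_ne_top (μ := P)
    (f := fun ω => (arrivals (fun k => s k ω) 0 T : ℝ≥0∞))
    (measurable_from_nat.comp (hs.measurable_arrivals_zero T)).aemeasurable
    (by rw [hs.lintegral_arrivals hT]; exact ENNReal.ofReal_ne_top)
  simpa using h

lemma integral_arrivals (hs : IsUnitPoissonProcess P s) {T : ℝ} (hT : 0 ≤ T) :
    ∫ ω, (arrivals (fun k => s k ω) 0 T : ℝ) ∂P = T := by
  have h := integral_toReal (μ := P)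
    (f := fun ω => (arrivals (fun k => s k ω) 0 T : ℝ≥0∞))
    (measurable_from_nat.comp (hs.measurable_arrivals_zero T)).aemeasurable
    (.of_forall fun ω => ENNReal.natCast_lt_top _)
  rw [hs.lintegral_arrivals hT, ENNReal.toReal_ofReal hT] at h
  simpa using h

/-- Strong law of large numbers for the independent Poisson counts of successive intervals of length
`L`. -/
lemma tendsto_arrivals_div (hs : IsUnitPoissonProcess P s) {L : ℝ} (hL : 0 ≤ L) :
    ∀ᵐ ω ∂P, Tendsto (fun n : ℕ => (arrivals (fun k => s k ω) 0 (n * L) : ℝ) / n)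
      atTop (nhds L) := by
  set τ : ℕ → ℝ := fun n => n * L with hτ
  have hτ0 : τ 0 = 0 := by simp [hτ]
  have hτ1 : τ 1 = L := by simp [hτ]
  have hmono : Monotone τ := fun m n h => by
    have : (m : ℝ) ≤ n := by exact_mod_cast h
    simp only [hτ]
    gcongr
  have hlaw : ∀ j, HasLaw (fun ω => arrivals (fun k => s k ω) (τ j) (τ (j + 1)))
      (poissonMeasure L.toNNReal) P := by
    intro j
    have := hs.law (τ j) (τ (j + 1)) (hτ0 ▸ hmono (Nat.zero_le j)) (hmono j.le_succ)
    convert this using 3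
    simp only [hτ]
    push_cast
    ring
  have key := strong_law_ae_real (μ := P)
    (fun j ω => (arrivals (fun k => s k ω) (τ j) (τ (j + 1)) : ℝ))
    (by simpa only [hτ0, zero_add, hτ1] using hs.integrable_arrivals hL)
    (fun i j hij => ((hs.indep τ hτ0.ge hmono).indepFun hij).comp
      (measurable_from_nat (f := fun n => (n : ℝ))) (measurable_from_nat (f := fun n => (n : ℝ))))
    (fun j => IdentDistrib.comp ⟨(hlaw j).aemeasurable, (hlaw 0).aemeasurable,
      (hlaw j).map_eq.trans (hlaw 0).map_eq.symm⟩ (measurable_from_nat (f := fun n => (n : ℝ))))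
  filter_upwards [key] with ω hω
  simp only [hτ0, zero_add, hτ1] at hω
  rw [hs.integral_arrivals hL] at hω
  refine hω.congr fun n => ?_
  rw [← Nat.cast_sum, sum_arrivals (hs.tendsto ω) hmono, hτ0]

lemma measure_arrivals_eq_zero (hs : IsUnitPoissonProcess P s) {a b : ℝ} (ha : 0 ≤ a)
    (hab : a ≤ b) :
    P {ω | arrivals (fun k => s k ω) a b = 0} = ENNReal.ofReal (Real.exp (-(b - a))) := by
  rw [(hs.law a b ha hab).measure_eq (p := fun n => n = 0) (by measurability)]
  have : {x : ℕ | x = 0} = {0} := rfl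
  rw [this, poissonMeasure_singleton]
  simp [Real.coe_toNNReal _ (sub_nonneg.2 hab)]

end IsUnitPoissonProcess

/-- The event that no update is transmitted at the scheduled times `n - k, …, n`. -/
def bestEffortIdle (d dbar E Ebar : ℝ) (s sbar : ℕ → Ω → ℝ) (n k : ℕ) : Set Ω :=
  {ω | ∀ j, n - k ≤ j → j ≤ n →
    ¬ BestEffortSends d dbar E Ebar (fun k => s k ω) (fun k => sbar k ω) j}

lemma measurableSet_sends (hs : IsUnitPoissonProcess P s) (hsbar : IsUnitPoissonProcess P sbar)
    (n : ℕ) : MeasurableSet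
      {ω | BestEffortSends d dbar E Ebar (fun k => s k ω) (fun k => sbar k ω) n} :=
  hs.history_le hsbar (slot d dbar n) _ (measurableSet_bestEffortSends hs.tendsto hsbar.tendsto le_rfl)

lemma measurableSet_bestEffortIdle (hs : IsUnitPoissonProcess P s)
    (hsbar : IsUnitPoissonProcess P sbar) (n k : ℕ) :
    MeasurableSet (bestEffortIdle d dbar E Ebar s sbar n k) := by
  unfold bestEffortIdle
  simp_rw [Set.ofPred_forall]
  exact .iInter fun j => .iInter fun _ => .iInter fun _ => (measurableSet_sends hs hsbar j).compl

/-- One of the two nodes has no arrivals in a window of length at least `k`, as slots have length at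
least 1; the union bound gives the factor 2. -/
lemma measureReal_bestEffortIdle_le [IsProbabilityMeasure P] (hs : IsUnitPoissonProcess P s)
    (hsbar : IsUnitPoissonProcess P sbar) (hE : 0 < E) (hEbar : 0 < Ebar) {n k : ℕ} (hkn : k ≤ n) :
    P.real (bestEffortIdle d dbar E Ebar s sbar n k) ≤ 2 * Real.exp (-1) ^ k := by
  have hle : slot d dbar (n - k) ≤ slot d dbar n := slot_mono (Nat.sub_le n k)
  have hdiff : (k : ℝ) ≤ slot d dbar n - slot d dbar (n - k) := by
    unfold slot
    rw [Nat.cast_sub hkn]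
    nlinarith [le_max_left 1 (d + dbar), k.cast_nonneg (α := ℝ)]
  have hexp : ENNReal.ofReal (Real.exp (-(slot d dbar n - slot d dbar (n - k)))) ≤
      ENNReal.ofReal (Real.exp (-1) ^ k) := by
    rw [← Real.exp_nat_mul]
    exact ENNReal.ofReal_le_ofReal (Real.exp_le_exp.2 (by linarith))
  refine ENNReal.toReal_le_of_le_ofReal (by positivity) ?_
  calc P (bestEffortIdle d dbar E Ebar s sbar n k)
      ≤ P ({ω | arrivals (fun k => s k ω) (slot d dbar (n - k)) (slot d dbar n) = 0} ∪
          {ω | arrivals (fun k => sbar k ω) (slot d dbar (n - k)) (slot d dbar n) = 0}) :=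
        measure_mono fun ω hω => arrivals_eq_zero_of_idle (hs.tendsto ω) (hsbar.tendsto ω)
          hE hEbar (Nat.sub_le n k) hω
    _ ≤ _ := measure_union_le _ _
    _ ≤ ENNReal.ofReal (Real.exp (-1) ^ k) + ENNReal.ofReal (Real.exp (-1) ^ k) := by
        rw [hs.measure_arrivals_eq_zero (slot_nonneg _) hle,
          hsbar.measure_arrivals_eq_zero (slot_nonneg _) hle]
        gcongr
    _ = _ := by
        rw [← ENNReal.ofReal_add (by positivity) (by positivity), two_mul]

/-- The average is the expected fraction of missed slots. That fraction lies in [0, 1] and tends to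
0 almost surely, so bounded convergence applies. -/
lemma tendsto_average_not_sends [IsProbabilityMeasure P] (hs : IsUnitPoissonProcess P s)
    (hsbar : IsUnitPoissonProcess P sbar) (hE : 0 < E) (hEbar : 0 < Ebar) :
    Tendsto (fun N : ℕ => (∑ j ∈ Finset.range N, P.real
      {ω | BestEffortSends d dbar E Ebar (fun k => s k ω) (fun k => sbar k ω) j}ᶜ) / N)
      atTop (nhds 0) := by
  classical
  set S : ℕ → Set Ω := fun j =>
    {ω | BestEffortSends d dbar E Ebar (fun k => s k ω) (fun k => sbar k ω) j}ᶜ with hS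
  have hSm : ∀ j, MeasurableSet (S j) := fun j => (measurableSet_sends hs hsbar j).compl
  set f : ℕ → Ω → ℝ := fun N ω => (∑ j ∈ Finset.range N, (S j).indicator 1 ω) / N with hf
  have hint : ∀ N, ∫ ω, f N ω ∂P = (∑ j ∈ Finset.range N, P.real (S j)) / N := by
    intro N
    simp only [hf]
    have hSi : ∀ j, Integrable ((S j).indicator (1 : Ω → ℝ)) P := fun j =>
      (integrable_const (1 : ℝ)).indicator (hSm j)
    rw [integral_div, integral_finsetSum _ fun j _ => hSi j]
    rw [Finset.sum_congr rfl fun j _ => integral_indicator_one (hSm j)]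
  refine Tendsto.congr hint ?_
  have hcount : ∀ ω N, ∑ j ∈ Finset.range N, (S j).indicator (1 : Ω → ℝ) ω =
      N - Nat.count (BestEffortSends d dbar E Ebar (fun k => s k ω) (fun k => sbar k ω)) N := by
    intro ω N
    induction N with
    | zero => simp
    | succ N ih =>
      rw [Finset.sum_range_succ, ih, Nat.count_succ]
      by_cases h : BestEffortSends d dbar E Ebar (fun k => s k ω) (fun k => sbar k ω) N
      · simp [hS, h]
      · simp [hS, h]
        ring
  have hL : 0 ≤ max 1 (d + dbar) := zero_le_one.trans (le_max_left _ _)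
  have := tendsto_integral_of_dominated_convergence (μ := P) (F := f) (f := fun _ => (0 : ℝ))
    (fun _ => (1 : ℝ)) (fun N => ?_) (integrable_const _) (fun N => .of_forall fun ω => ?_) ?_
  · simpa using this
  · refine Measurable.aestronglyMeasurable (Measurable.div_const ?_ _)
    exact Finset.measurable_fun_sum _ fun j _ => measurable_one.indicator (hSm j)
  · simp only [hf, hcount]
    have h1 : (Nat.count (BestEffortSends d dbar E Ebar (fun k => s k ω)
        (fun k => sbar k ω)) N : ℝ) ≤ N := by exact_mod_cast Nat.count_le _
    rw [Real.norm_of_nonneg (div_nonneg (sub_nonneg.2 h1) (Nat.cast_nonneg N))]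
    exact div_le_one_of_le₀ (sub_le_self _ (Nat.cast_nonneg _)) (Nat.cast_nonneg N)
  · filter_upwards [hs.tendsto_arrivals_div hL, hsbar.tendsto_arrivals_div hL] with ω h1 h2
    simp only [hf, hcount]
    exact tendsto_missed_div (hs.tendsto ω) (hsbar.tendsto ω) hE hEbar (le_max_left _ _) h1 h2

lemma tendsto_average_idle [IsProbabilityMeasure P] (hs : IsUnitPoissonProcess P s)
    (hsbar : IsUnitPoissonProcess P sbar) (hE : 0 < E) (hEbar : 0 < Ebar) :
    Tendsto (fun N : ℕ => (∑ n ∈ Finset.range N, ∑ k ∈ Finset.range n,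
      P.real (bestEffortIdle d dbar E Ebar s sbar n k)) / N) atTop (nhds 0) := by
  refine tendsto_average_triangular (fun n k => measureReal_nonneg) (fun j => measureReal_nonneg)
    (q := fun k => 2 * Real.exp (-1) ^ k) ?_ (fun n k hk => ?_) (fun n k hk =>
    measureReal_bestEffortIdle_le hs hsbar hE hEbar hk.le)
    (tendsto_average_not_sends (d := d) (dbar := dbar) hs hsbar hE hEbar)
  · exact (summable_geometric_of_lt_one (Real.exp_pos _).le
      (Real.exp_lt_one_iff.2 (by norm_num))).mul_left 2
  · exact measureReal_mono fun ω hω => hω (n - k) le_rfl (Nat.sub_le n k)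

end

/-! ### The average age of the best-effort policy -/

section

variable {Ω : Type*} {s sbar : ℕ → Ω → ℝ} {d dbar E Ebar : ℝ}

lemma bestEffort_age_le {ω : Ω} {m : ℕ} {τ : ℝ} (hd : 0 < d) (hdbar : 0 < dbar)
    (hm : BestEffortSends d dbar E Ebar (fun k => s k ω) (fun k => sbar k ω) m)
    (hτ : slot d dbar m + (d + dbar) ≤ τ) :
    (bestEffort d dbar E Ebar s sbar).age dbar τ ω ≤ ENNReal.ofReal (τ - slot d dbar m) := by
  classical
  rw [Policy.age, ENNReal.ofReal_sub _ (slot_nonneg m)]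
  refine tsub_le_tsub_left ?_ _
  have ht := bestEffortTime_eq hm rfl
  have hm0 := slot_nonneg (d := d) (dbar := dbar) m
  rw [← ht]
  refine le_iSup₂_of_le (f := fun (i : ℕ) (_ : (bestEffort d dbar E Ebar s sbar).tbar i ω +
    ENNReal.ofReal dbar ≤ ENNReal.ofReal τ) => (bestEffort d dbar E Ebar s sbar).t i ω) _ ?_ le_rfl
  simp only [bestEffort, ht]
  rw [← ENNReal.ofReal_add hm0 hd.le, ← ENNReal.ofReal_add (by positivity) hdbar.le, add_assoc]
  exact ENNReal.ofReal_le_ofReal hτ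

/-- With `m` the last used slot up to `n`, the idle events hold for all `k < n - m`. Such an `m`
exists because slot 0 is always used. -/
lemma exists_sends_sub_le_sum_idle (ω : Ω) (n : ℕ) :
    ∃ m ≤ n, BestEffortSends d dbar E Ebar (fun k => s k ω) (fun k => sbar k ω) m ∧
      ((n - m : ℕ) : ℝ≥0∞) ≤ ∑ k ∈ Finset.range n,
        (bestEffortIdle d dbar E Ebar s sbar n k).indicator 1 ω := by
  classical
  set p := BestEffortSends d dbar E Ebar (fun k => s k ω) (fun k => sbar k ω) with hp
  have h0 : p 0 := bestEffortSends_zero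
  refine ⟨Nat.findGreatest p n, Nat.findGreatest_le n,
    Nat.findGreatest_spec (Nat.zero_le n) h0, ?_⟩
  set m := Nat.findGreatest p n
  calc ((n - m : ℕ) : ℝ≥0∞) = ∑ k ∈ Finset.range (n - m), 1 := by simp
    _ = ∑ k ∈ Finset.range (n - m),
        (bestEffortIdle d dbar E Ebar s sbar n k).indicator (1 : Ω → ℝ≥0∞) ω := by
        refine Finset.sum_congr rfl fun k hk => ?_
        rw [Set.indicator_of_mem, Pi.one_apply]
        intro j hj1 hj2
        have := Finset.mem_range.1 hk
        exact Nat.findGreatest_is_greatest (P := p) (show m < j by omega) hj2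
    _ ≤ _ := Finset.sum_le_sum_of_subset (Finset.range_subset_range.2 (Nat.sub_le n m))

lemma setLIntegral_Ico_ofReal_sub (l : ℝ) {D L : ℝ} (hD : 0 ≤ D) (hL : 0 ≤ L) :
    ∫⁻ τ in Set.Ico (l + D) (l + L + D), ENNReal.ofReal (τ - l) =
      ENNReal.ofReal (D * L + L ^ 2 / 2) := by
  rw [← ofReal_integral_eq_lintegral_ofReal]
  · rw [integral_Ico_eq_integral_Ioo, ← integral_Ioc_eq_integral_Ioo,
      ← intervalIntegral.integral_of_le (by linarith)]
    rw [intervalIntegral.integral_sub (by simp) (by simp)]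
    simp only [intervalIntegral.integral_const, integral_id, smul_eq_mul]
    congr 1
    ring
  · exact ((by fun_prop : Continuous fun τ => τ - l).continuousOn.integrableOn_Icc).mono_set
      Set.Ico_subset_Icc_self
  · exact (ae_restrict_iff' measurableSet_Ico).2
      (Eventually.of_forall fun x hx => sub_nonneg.2 (by linarith [hx.1]))

/-- Time is cut at the instants `n * L + (d + dbar)`, when an update sent at slot `n` is received.
The first piece, before any reception, contributes at most `(d + dbar) ^ 2`. -/
lemma setLIntegral_bestEffort_age_le (hd : 0 < d) (hdbar : 0 < dbar) {L : ℝ}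
    (hL : L = max 1 (d + dbar)) (ω : Ω) (N : ℕ) :
    ∫⁻ τ in Set.Ico 0 (N * L + (d + dbar)), (bestEffort d dbar E Ebar s sbar).age dbar τ ω ≤
      ENNReal.ofReal ((d + dbar) ^ 2) + ∑ n ∈ Finset.range N,
        (ENNReal.ofReal ((d + dbar) * L + L ^ 2 / 2) + ENNReal.ofReal (L ^ 2) *
          ∑ k ∈ Finset.range n, (bestEffortIdle d dbar E Ebar s sbar n k).indicator 1 ω) := by
  have hL0 : 0 < L := by rw [hL]; positivity
  have hslot : ∀ n, slot d dbar n = n * L := fun n => by rw [slot, hL]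
  induction N with
  | zero =>
    simp only [Nat.cast_zero, zero_mul, zero_add, Finset.range_zero, Finset.sum_empty, add_zero]
    calc _ ≤ ∫⁻ τ in Set.Ico 0 (d + dbar), ENNReal.ofReal (d + dbar) :=
          setLIntegral_mono' measurableSet_Ico fun τ hτ =>
            tsub_le_self.trans (ENNReal.ofReal_le_ofReal hτ.2.le)
      _ = _ := by
          rw [setLIntegral_const, Real.volume_Ico, ← ENNReal.ofReal_mul (by positivity)]
          ring_nf
  | succ n ih =>
    set A := ∑ k ∈ Finset.range n,
      (bestEffortIdle d dbar E Ebar s sbar n k).indicator (1 : Ω → ℝ≥0∞) ω with hA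
    have hsub : Set.Ico 0 (((n + 1 : ℕ) : ℝ) * L + (d + dbar)) ⊆
        Set.Ico 0 (n * L + (d + dbar)) ∪ Set.Ico (n * L + (d + dbar)) (n * L + L + (d + dbar)) := by
      intro x hx
      push_cast at hx
      rcases lt_or_ge x (n * L + (d + dbar)) with h | h
      · exact Or.inl ⟨hx.1, h⟩
      · exact Or.inr ⟨h, by linarith [hx.2]⟩
    refine (lintegral_mono_set hsub).trans ((lintegral_union_le _ _ _).trans ?_)
    rw [Finset.sum_range_succ, ← add_assoc (ENNReal.ofReal ((d + dbar) ^ 2))]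
    refine add_le_add ih ?_
    obtain ⟨m, hmn, hm, hmA⟩ := exists_sends_sub_le_sum_idle (d := d) (dbar := dbar) (E := E)
      (Ebar := Ebar) (s := s) (sbar := sbar) ω n
    -- The ideal age in period `n`, plus `L` for each slot elapsed since the last used one.
    have hage : ∀ τ ∈ Set.Ico (n * L + (d + dbar)) (n * L + L + (d + dbar)),
        (bestEffort d dbar E Ebar s sbar).age dbar τ ω ≤
          ENNReal.ofReal (τ - n * L) + ENNReal.ofReal L * A := by
      intro τ hτ
      have hmn' : (m : ℝ) ≤ n := by exact_mod_cast hmn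
      refine (bestEffort_age_le hd hdbar hm ?_).trans ?_
      · rw [hslot]
        nlinarith [hτ.1]
      · calc ENNReal.ofReal (τ - slot d dbar m)
            = ENNReal.ofReal (τ - n * L + L * (n - m : ℕ)) := by
              rw [hslot, Nat.cast_sub hmn]
              ring_nf
          _ ≤ ENNReal.ofReal (τ - n * L) + ENNReal.ofReal (L * (n - m : ℕ)) :=
              ENNReal.ofReal_add_le
          _ ≤ _ := by
              rw [ENNReal.ofReal_mul hL0.le, ENNReal.ofReal_natCast]
              gcongr
    refine (setLIntegral_mono' measurableSet_Ico hage).trans ?_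
    rw [lintegral_add_left (by fun_prop), setLIntegral_Ico_ofReal_sub _ (by positivity) hL0.le,
      setLIntegral_const, Real.volume_Ico]
    have h1 : (n : ℝ) * L + L + (d + dbar) - (n * L + (d + dbar)) = L := by ring
    rw [h1, mul_right_comm, ← ENNReal.ofReal_mul hL0.le, ← sq]

variable [MeasurableSpace Ω] {P : Measure Ω} [IsProbabilityMeasure P]

lemma lintegral_bestEffort_area_le (hs : IsUnitPoissonProcess P s)
    (hsbar : IsUnitPoissonProcess P sbar) (hd : 0 < d) (hdbar : 0 < dbar) {L : ℝ}
    (hL : L = max 1 (d + dbar)) {T : ℝ} {N : ℕ} (hT : T ≤ N * L) :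
    ∫⁻ ω, (bestEffort d dbar E Ebar s sbar).area dbar T ω ∂P ≤
      ENNReal.ofReal ((d + dbar) ^ 2 + (N * ((d + dbar) * L + L ^ 2 / 2) + L ^ 2 *
        ∑ n ∈ Finset.range N, ∑ k ∈ Finset.range n,
          P.real (bestEffortIdle d dbar E Ebar s sbar n k))) := by
  have hL0 : 0 < L := by rw [hL]; positivity
  have hm : ∀ n k, Measurable
      ((bestEffortIdle d dbar E Ebar s sbar n k).indicator (1 : Ω → ℝ≥0∞)) := fun n k =>
    measurable_one.indicator (measurableSet_bestEffortIdle hs hsbar n k)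
  have hm' : ∀ n, Measurable fun ω => ∑ k ∈ Finset.range n,
      (bestEffortIdle d dbar E Ebar s sbar n k).indicator (1 : Ω → ℝ≥0∞) ω := fun n =>
    Finset.measurable_fun_sum _ fun k _ => hm n k
  have hm'' : ∀ n, Measurable fun ω => ENNReal.ofReal ((d + dbar) * L + L ^ 2 / 2) +
      ENNReal.ofReal (L ^ 2) * ∑ k ∈ Finset.range n,
      (bestEffortIdle d dbar E Ebar s sbar n k).indicator (1 : Ω → ℝ≥0∞) ω := fun n =>
    ((hm' n).const_mul _).const_add _
  calc _ ≤ ∫⁻ ω, (ENNReal.ofReal ((d + dbar) ^ 2) + ∑ n ∈ Finset.range N,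
        (ENNReal.ofReal ((d + dbar) * L + L ^ 2 / 2) + ENNReal.ofReal (L ^ 2) *
          ∑ k ∈ Finset.range n,
            (bestEffortIdle d dbar E Ebar s sbar n k).indicator (1 : Ω → ℝ≥0∞) ω)) ∂P := by
        refine lintegral_mono fun ω => le_trans (lintegral_mono_set fun x hx => ?_)
          (setLIntegral_bestEffort_age_le hd hdbar hL ω N)
        exact ⟨hx.1, by linarith [hx.2]⟩
    _ = ENNReal.ofReal ((d + dbar) ^ 2) + ∑ n ∈ Finset.range N,
        (ENNReal.ofReal ((d + dbar) * L + L ^ 2 / 2) + ENNReal.ofReal (L ^ 2) *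
          ∑ k ∈ Finset.range n, P (bestEffortIdle d dbar E Ebar s sbar n k)) := by
        rw [lintegral_add_left measurable_const, lintegral_finsetSum _ fun n _ => hm'' n]
        congr 1
        · simp
        · refine Finset.sum_congr rfl fun n _ => ?_
          rw [lintegral_add_left measurable_const, lintegral_const_mul _ (hm' n),
            lintegral_finsetSum _ fun k _ => hm n k]
          simp_rw [lintegral_indicator_one (measurableSet_bestEffortIdle hs hsbar n _)]
          simp
    _ = _ := by
        have hP : ∀ n k, P (bestEffortIdle d dbar E Ebar s sbar n k) =
            ENNReal.ofReal (P.real (bestEffortIdle d dbar E Ebar s sbar n k)) := fun n k =>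
          (ofReal_measureReal).symm
        have hsum : ∀ n, 0 ≤ ∑ k ∈ Finset.range n,
            P.real (bestEffortIdle d dbar E Ebar s sbar n k) := fun n =>
          Finset.sum_nonneg fun k _ => measureReal_nonneg
        simp_rw [hP]
        simp_rw [← ENNReal.ofReal_sum_of_nonneg fun _ _ => measureReal_nonneg]
        simp_rw [← ENNReal.ofReal_mul (sq_nonneg L)]
        simp_rw [← ENNReal.ofReal_add (show 0 ≤ (d + dbar) * L + L ^ 2 / 2 by positivity)
          (mul_nonneg (sq_nonneg L) (hsum _))]
        rw [← ENNReal.ofReal_sum_of_nonneg fun n _ => add_nonneg (by positivity)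
          (mul_nonneg (sq_nonneg L) (hsum n)), ← ENNReal.ofReal_add (by positivity)
          (Finset.sum_nonneg fun n _ => add_nonneg (by positivity)
          (mul_nonneg (sq_nonneg L) (hsum n)))]
        rw [Finset.sum_add_distrib, ← Finset.mul_sum, Finset.sum_const, Finset.card_range,
          nsmul_eq_mul]

theorem bestEffort_longTermAoI_le (hs : IsUnitPoissonProcess P s)
    (hsbar : IsUnitPoissonProcess P sbar) (hd : 0 < d) (hdbar : 0 < dbar) (hE : 0 < E)
    (hEbar : 0 < Ebar) {L : ℝ} (hL : L = max 1 (d + dbar)) :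
    (bestEffort d dbar E Ebar s sbar).longTermAoI P dbar ≤ ENNReal.ofReal (d + dbar + L / 2) := by
  have hL0 : 0 < L := by rw [hL]; positivity
  set S : ℕ → ℝ := fun N => ∑ n ∈ Finset.range N, ∑ k ∈ Finset.range n,
    P.real (bestEffortIdle d dbar E Ebar s sbar n k) with hS
  set W := (d + dbar) * L + L ^ 2 / 2 with hW
  have hdivL : Tendsto (fun T : ℝ => T / L) atTop atTop := tendsto_id.atTop_div_const hL0
  have hceil : Tendsto (fun T : ℝ => ⌈T / L⌉₊) atTop atTop :=
    tendsto_nat_ceil_atTop.comp hdivL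
  have hratio : Tendsto (fun T : ℝ => (⌈T / L⌉₊ : ℝ) / (T / L)) atTop (nhds 1) :=
    (tendsto_nat_ceil_div_atTop (R := ℝ)).comp hdivL
  have hidle : Tendsto (fun T : ℝ => S ⌈T / L⌉₊ / (⌈T / L⌉₊ : ℝ)) atTop (nhds 0) :=
    (tendsto_average_idle (d := d) (dbar := dbar) hs hsbar hE hEbar).comp hceil
  -- With `N = ⌈T / L⌉₊` periods covering `[0, T]`, this is the area bound divided by `T`, factored
  -- so that each piece has a known limit; `W / L` is the claimed value.
  have hlim : Tendsto (fun T : ℝ => ENNReal.ofReal ((d + dbar) ^ 2 / T +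
      (⌈T / L⌉₊ : ℝ) / (T / L) * (L⁻¹ * (W + L ^ 2 * (S ⌈T / L⌉₊ / (⌈T / L⌉₊ : ℝ))))))
      atTop (nhds (ENNReal.ofReal (d + dbar + L / 2))) := by
    refine ENNReal.tendsto_ofReal ?_
    have h1 : Tendsto (fun T : ℝ => (d + dbar) ^ 2 / T) atTop (nhds 0) :=
      tendsto_const_nhds.div_atTop tendsto_id
    have h2 := h1.add (hratio.mul (((hidle.const_mul (L ^ 2)).const_add W).const_mul L⁻¹))
    convert h2 using 2
    rw [hW]
    field_simp
    ring
  refine le_trans (limsup_le_limsup ?_) hlim.limsup_eq.le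
  filter_upwards [eventually_gt_atTop 0] with T hT
  have hNL : T ≤ (⌈T / L⌉₊ : ℝ) * L := (div_le_iff₀ hL0).1 (Nat.le_ceil _)
  have hN0 : (0 : ℝ) < ⌈T / L⌉₊ := by
    exact_mod_cast Nat.ceil_pos.2 (by positivity)
  have hS0 : ∀ N, 0 ≤ S N := fun N =>
    Finset.sum_nonneg fun n _ => Finset.sum_nonneg fun k _ => measureReal_nonneg
  refine ENNReal.div_le_of_le_mul ?_
  rw [← ENNReal.ofReal_mul' hT.le]
  refine (lintegral_bestEffort_area_le hs hsbar hd hdbar hL hNL).trans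
    (ENNReal.ofReal_le_ofReal (le_of_eq ?_))
  change (d + dbar) ^ 2 + ((⌈T / L⌉₊ : ℝ) * W + L ^ 2 * S ⌈T / L⌉₊) = _
  generalize hx : (⌈T / L⌉₊ : ℝ) = x at *
  field_simp

end

theorem theorem4 {Ω : Type*} [MeasurableSpace Ω] (P : Measure Ω) [IsProbabilityMeasure P]
    (s sbar : ℕ → Ω → ℝ)
    (hs : IsUnitPoissonProcess P s) (hsbar : IsUnitPoissonProcess P sbar)
    (hindep : IndepFun (fun ω k => s k ω) (fun ω k => sbar k ω) P)
    (d dbar E Ebar : ℝ) (hd : 0 < d) (hdbar : 0 < dbar) (hE : 0 < E) (hEbar : 0 < Ebar) :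
    (bestEffort d dbar E Ebar s sbar).IsFeasible P s sbar d dbar E Ebar ∧
    (bestEffort d dbar E Ebar s sbar).IsOnline s sbar ∧
    (bestEffort d dbar E Ebar s sbar).longTermAoI P dbar =
      ENNReal.ofReal (max (1 / 2 + d + dbar) (3 / 2 * (d + dbar))) ∧
    ∀ π : Policy Ω, π.IsFeasible P s sbar d dbar E Ebar →
      ENNReal.ofReal (max (1 / 2 + d + dbar) (3 / 2 * (d + dbar))) ≤ π.longTermAoI P dbar := by
  have hval : max (1 / 2 + d + dbar) (3 / 2 * (d + dbar)) =
      d + dbar + max 1 (d + dbar) / 2 := by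
    rcases le_total 1 (d + dbar) with h | h
    · rw [max_eq_right h, max_eq_right (by linarith)]
      ring
    · rw [max_eq_left h, max_eq_left (by linarith)]
      ring
  rw [hval]
  have hfeas := bestEffort_isFeasible (E := E) hs hsbar hd hdbar hEbar
  exact ⟨hfeas, bestEffort_isOnline hs.tendsto hsbar.tendsto hd,
    le_antisymm (bestEffort_longTermAoI_le hs hsbar hd hdbar hE hEbar rfl)
      (hfeas.le_longTermAoI hs hd hdbar hE rfl),
    fun π hπ => hπ.le_longTermAoI hs hd hdbar hE rfl⟩
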